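/- Let $s,m$ be natural numbers with $s\ge 1$, let $U\subseteq\mathbb{R}^m$ be open (for instance $U=\mathbb{R}^m$), let $H:U\to\mathbb{R}$ be of class $C^{s+1}$ and let $B:U\to\mathbb{R}^{m\times m}$ be of class $C^{s}$ with $B(y)^\top=-B(y)$ for all $y\in U$. Let $y_0\in U$, $T>0$, and let $y:[0,T]\to U$ be the solution of the Poisson problem $$\dot y = B(y)\nabla H(y),\qquad y(0)=y_0 .$$ Let $\{P_j\}_{j\ge0}$ be the Legendre polynomials orthonormal on $[0,1]$: $\deg P_j=j$, $\int_0^1P_i(x)P_j(x)\,\mathrm{d}x=\delta_{ij}$, with positive leading coefficients. For a step size $h>0$ and a path $\sigma:[0,h]\to U$ put $$\gamma_j(\sigma)=\int_0^1P_j(\tau)\nabla H(\sigma(\tau h))\,\mathrm{d}\tau,\qquad \rho_{ij}(\sigma)=\int_0^1P_i(\tau)P_j(\tau)B(\sigma(\tau h))\,\mathrm{d}\tau ,$$ and consider the continuous procedure: find $\sigma$ with $\sigma(0)=y_0$ and $$\dot\sigma(ch)=\sum_{i,j=0}^{s-1}P_i(c)\,\rho_{ij}(\sigma)\,\gamma_j(\sigma),\qquad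 c\in[0,1],\qquad\text{and set } y_1:=\sigma(h).$$ (Here $\dot\sigma(ch)$ is the derivative with respect to $t$ at $t=ch$.) Then the procedure is well defined for small step sizes and its local error is $y_1-y(h)=O(h^{2s+1})$ as $h\to0^+$, that is, the procedure has order of convergence $2s$. Precisely: for every compact set $K\subseteq U$ whose interior contains $y_0$ there are $h_0\in(0,T]$ and $C$ such that for every $h\in(0,h_0]$ the procedure has exactly one solution $\sigma$ on $[0,h]$ with $\sigma([0,h])\subseteq K$, and for it $$\|\sigma(h)-y(h)\|\le C\,h^{2s+1}.$$ -/

import Mathlib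

open scoped Matrix Gradient

noncomputable section

namespace PoissonHBVM

/-! ### The orthonormal Legendre basis on `[0,1]` -/

/-- The orthonormal Legendre polynomial of degree `j` on `[0,1]`, with positive leading
coefficient (so that `legendreP 0 = 1`). -/
def legendreP (j : ℕ) : Polynomial ℝ :=
  Polynomial.C ((-1) ^ j * Real.sqrt (2 * j + 1)) *
    (Polynomial.shiftedLegendre j).map (Int.castRingHom ℝ)

theorem legendreP_zero : legendreP 0 = 1 := by
  simp [legendreP, Polynomial.shiftedLegendre]

theorem degree_legendreP (j : ℕ) : (legendreP j).degree = j := by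
  have h : ((-1 : ℝ) ^ j * Real.sqrt (2 * j + 1)) ≠ 0 :=
    mul_ne_zero (pow_ne_zero _ (by norm_num)) (Real.sqrt_ne_zero'.2 (by positivity))
  rw [legendreP, Polynomial.degree_C_mul h,
    Polynomial.degree_map_eq_of_injective (Int.castRingHom ℝ).injective_int,
    Polynomial.degree_shiftedLegendre]

theorem poly_int (p : Polynomial ℝ) :
    IntervalIntegrable (fun x => p.eval x) MeasureTheory.volume 0 1 :=
  p.continuous.intervalIntegrable 0 1

theorem ibp (p q : Polynomial ℝ) (h0 : p.eval 0 = 0) (h1 : p.eval 1 = 0) :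
    ∫ x in (0 : ℝ)..1, (q * p.derivative).eval x =
      - ∫ x in (0 : ℝ)..1, (q.derivative * p).eval x := by
  have h : ∫ x in (0 : ℝ)..1, ((q * p).derivative).eval x = 0 := by
    rw [intervalIntegral.integral_eq_sub_of_hasDerivAt
      (fun x _ => (q * p).hasDerivAt x) (poly_int _)]
    simp [h0, h1]
  rw [Polynomial.derivative_mul] at h
  simp only [Polynomial.eval_add] at h
  rw [intervalIntegral.integral_add (poly_int _) (poly_int _)] at h
  linarith

theorem ibp_iter (n k : ℕ) (hk : k ≤ n) (q : Polynomial ℝ) :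
    ∫ x in (0 : ℝ)..1, (q * Polynomial.derivative^[k]
        (Polynomial.X ^ n * (1 - Polynomial.X) ^ n)).eval x =
      (-1) ^ k * ∫ x in (0 : ℝ)..1, (Polynomial.derivative^[k] q *
        (Polynomial.X ^ n * (1 - Polynomial.X) ^ n)).eval x := by
  induction k generalizing q with
  | zero => simp
  | succ k ih =>
    have hz : ∀ r : Polynomial ℝ, ∀ a : ℝ, r.eval a = 0 →
        r ^ n ∣ (Polynomial.X ^ n * (1 - Polynomial.X) ^ n) →
        (Polynomial.derivative^[k] (Polynomial.X ^ n * (1 - Polynomial.X) ^ n)).eval a = 0 := by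
      intro r a hr hd
      obtain ⟨t, ht⟩ := Polynomial.pow_sub_dvd_iterate_derivative_of_pow_dvd k hd
      rw [ht, Polynomial.eval_mul, Polynomial.eval_pow, hr, zero_pow (by omega), zero_mul]
    rw [Function.iterate_succ_apply', ibp _ _
      (hz Polynomial.X 0 (by simp) (Dvd.intro _ rfl))
      (hz (1 - Polynomial.X) 1 (by simp) (Dvd.intro_left _ rfl)),
      ih (by omega), Function.iterate_succ_apply]
    ring

theorem beta (b a : ℕ) :
    ((a + b + 1).factorial : ℝ) * ∫ x in (0 : ℝ)..1,
      ((Polynomial.X ^ a * (1 - Polynomial.X) ^ b : Polynomial ℝ)).eval x =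
      a.factorial * b.factorial := by
  induction b generalizing a with
  | zero =>
    have h : ((a : ℝ) + 1) ≠ 0 := by positivity
    simp [Nat.factorial_succ]
    field_simp
  | succ b ih =>
    have h := ibp (Polynomial.X ^ (a + 1) * (1 - Polynomial.X) ^ (b + 1)) 1 (by simp) (by simp)
    have e : (1 * Polynomial.derivative
          (Polynomial.X ^ (a + 1) * (1 - Polynomial.X) ^ (b + 1)) : Polynomial ℝ) =
        Polynomial.C ((a : ℝ) + 1) * (Polynomial.X ^ a * (1 - Polynomial.X) ^ (b + 1)) -
        Polynomial.C ((b : ℝ) + 1) * (Polynomial.X ^ (a + 1) * (1 - Polynomial.X) ^ b) := by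
      simp [Polynomial.derivative_pow]
      ring
    rw [e] at h
    simp only [Polynomial.eval_sub, Polynomial.eval_C_mul] at h
    rw [intervalIntegral.integral_sub ((poly_int _).const_mul _) ((poly_int _).const_mul _),
      intervalIntegral.integral_const_mul, intervalIntegral.integral_const_mul] at h
    simp only [Polynomial.derivative_one, zero_mul, Polynomial.eval_zero,
      intervalIntegral.integral_zero, neg_zero] at h
    have h2 := ih (a + 1)
    rw [show a + 1 + b + 1 = a + (b + 1) + 1 by ring] at h2
    have ha : ((a : ℝ) + 1) ≠ 0 := by positivity
    apply mul_left_cancel₀ ha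
    rw [Nat.factorial_succ a] at h2
    rw [Nat.factorial_succ b]
    push_cast at h2 ⊢
    linear_combination (((a + (b + 1) + 1).factorial : ℝ)) * h + (b + 1) * h2

theorem rodrigues (q : Polynomial ℝ) (n : ℕ) :
    (n.factorial : ℝ) * ∫ x in (0 : ℝ)..1,
      (q * (Polynomial.shiftedLegendre n).map (Int.castRingHom ℝ)).eval x =
      (-1) ^ n * ∫ x in (0 : ℝ)..1, (Polynomial.derivative^[n] q *
        (Polynomial.X ^ n * (1 - Polynomial.X) ^ n)).eval x := by
  have h := congrArg (Polynomial.map (Int.castRingHom ℝ))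
    (Polynomial.factorial_mul_shiftedLegendre_eq n)
  rw [← Polynomial.iterate_derivative_map] at h
  simp only [Polynomial.map_mul, Polynomial.map_pow, Polynomial.map_sub, Polynomial.map_X,
    Polynomial.map_one, Polynomial.map_natCast] at h
  rw [← ibp_iter n n le_rfl q, ← h, ← intervalIntegral.integral_const_mul]
  congr 1
  ext x
  simp
  ring

theorem integral_lt {i j : ℕ} (hij : i < j) :
    ∫ x in (0 : ℝ)..1, (legendreP i).eval x * (legendreP j).eval x = 0 := by
  have h := rodrigues (legendreP i) j
  rw [Polynomial.iterate_derivative_eq_zero_of_degree_lt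
    (by rw [degree_legendreP]; exact_mod_cast hij)] at h
  simp only [zero_mul, Polynomial.eval_zero, intervalIntegral.integral_zero, mul_zero,
    mul_eq_zero] at h
  have h := h.resolve_left (by positivity)
  have e : ∀ x : ℝ, (legendreP i).eval x * (legendreP j).eval x =
      ((-1) ^ j * Real.sqrt (2 * j + 1)) * (legendreP i *
        (Polynomial.shiftedLegendre j).map (Int.castRingHom ℝ)).eval x := by
    intro x
    rw [Polynomial.eval_mul]
    nth_rewrite 2 [legendreP]
    rw [Polynomial.eval_C_mul]
    ring
  simp only [e]
  rw [intervalIntegral.integral_const_mul, h, mul_zero]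

theorem integral_self (j : ℕ) :
    ∫ x in (0 : ℝ)..1, (legendreP j).eval x * (legendreP j).eval x = 1 := by
  set L := (Polynomial.shiftedLegendre j).map (Int.castRingHom ℝ) with hL
  have h := rodrigues L j
  have hd : L.natDegree = j := by
    rw [hL, Polynomial.natDegree_map_eq_of_injective (Int.castRingHom ℝ).injective_int,
      Polynomial.natDegree_shiftedLegendre]
  have hD : Polynomial.derivative^[j] L =
      Polynomial.C ((j.factorial : ℝ) * ((-1) ^ j * (j + j).choose j)) := by
    have h0 : (Polynomial.derivative^[j] L).natDegree = 0 := by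
      have := Polynomial.natDegree_iterate_derivative L j
      omega
    rw [Polynomial.eq_C_of_natDegree_eq_zero h0, Polynomial.coeff_iterate_derivative]
    simp [hL, Polynomial.coeff_shiftedLegendre, Nat.descFactorial_self]
  rw [hD, ← hL] at h
  simp only [Polynomial.eval_C_mul] at h
  rw [intervalIntegral.integral_const_mul] at h
  have hb := beta j j
  have hc : ((j + j).choose j : ℝ) * (j.factorial * j.factorial) = (j + j).factorial := by
    have := Nat.add_choose_mul_factorial_mul_factorial j j
    rw [← this]
    push_cast
    ring
  have e : ∀ x : ℝ, (legendreP j).eval x * (legendreP j).eval x =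
      (2 * j + 1) * (L * L).eval x := by
    intro x
    rw [legendreP, Polynomial.eval_C_mul, ← hL, Polynomial.eval_mul]
    have h1 : ((-1 : ℝ) ^ j) * (-1) ^ j = 1 := by rw [← mul_pow]; simp
    have h2 : Real.sqrt (2 * j + 1) * Real.sqrt (2 * j + 1) = 2 * j + 1 :=
      Real.mul_self_sqrt (by positivity)
    linear_combination (Real.sqrt (2 * j + 1) * Real.sqrt (2 * j + 1) *
      (L.eval x * L.eval x)) * h1 + (L.eval x * L.eval x) * h2
  simp only [e]
  rw [intervalIntegral.integral_const_mul]
  have h1 : ((-1 : ℝ) ^ j) * (-1) ^ j = 1 := by rw [← mul_pow]; simp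
  have hf : (j.factorial : ℝ) ≠ 0 := by positivity
  have hg : ((j + j).factorial : ℝ) ≠ 0 := by positivity
  rw [Nat.factorial_succ] at hb
  push_cast at hb
  set I := ∫ x in (0 : ℝ)..1, (L * L).eval x
  set J := ∫ x in (0 : ℝ)..1,
      ((Polynomial.X ^ j * (1 - Polynomial.X) ^ j : Polynomial ℝ)).eval x
  have hI : I = ((j + j).choose j : ℝ) * J := by
    apply mul_left_cancel₀ hf
    rw [h]
    linear_combination (j.factorial * ((j + j).choose j) * J : ℝ) * h1
  apply mul_left_cancel₀ hg
  rw [hI]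
  linear_combination ((j + j).choose j : ℝ) * hb + hc

/-- The family `legendreP` is orthonormal in `L²(0,1)`. -/
theorem integral_legendreP (i j : ℕ) :
    ∫ x in (0 : ℝ)..1, (legendreP i).eval x * (legendreP j).eval x = if i = j then 1 else 0 := by
  rcases lt_trichotomy i j with h | h | h
  · rw [if_neg h.ne, integral_lt h]
  · subst h
    rw [if_pos rfl, integral_self]
  · rw [if_neg h.ne']
    simp only [mul_comm (Polynomial.eval _ (legendreP i))]
    exact integral_lt h

/-! ### Poisson problems and the continuous line integral procedure -/

variable {m : ℕ}

/-- The vector field `f(y) = B(y) ∇H(y)`. -/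
def vectorField (H : EuclideanSpace ℝ (Fin m) → ℝ)
    (B : EuclideanSpace ℝ (Fin m) → Matrix (Fin m) (Fin m) ℝ) (y : EuclideanSpace ℝ (Fin m)) :
    EuclideanSpace ℝ (Fin m) :=
  Matrix.toEuclideanLin (B y) (∇ H y)

/-- `y` solves `y' = B(y) ∇H(y)`, `y(0) = y₀` on `[0,T]`, with values in `U`. -/
structure IsPoissonSolution (U : Set (EuclideanSpace ℝ (Fin m)))
    (H : EuclideanSpace ℝ (Fin m) → ℝ)
    (B : EuclideanSpace ℝ (Fin m) → Matrix (Fin m) (Fin m) ℝ) (y₀ : EuclideanSpace ℝ (Fin m))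
    (T : ℝ) (y : ℝ → EuclideanSpace ℝ (Fin m)) : Prop where
  initial : y 0 = y₀
  mem : ∀ t ∈ Set.Icc 0 T, y t ∈ U
  ode : ∀ t ∈ Set.Icc 0 T, HasDerivWithinAt y (vectorField H B (y t)) (Set.Icc 0 T) t

/-- `γ_j(σ) = ∫₀¹ P_j(τ) ∇H(σ(τh)) dτ`. -/
def gammaCoeff (H : EuclideanSpace ℝ (Fin m) → ℝ) (h : ℝ) (σ : ℝ → EuclideanSpace ℝ (Fin m))
    (j : ℕ) : EuclideanSpace ℝ (Fin m) :=
  ∫ τ in (0 : ℝ)..1, (legendreP j).eval τ • ∇ H (σ (τ * h))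

/-- `ρ_ij(σ) = ∫₀¹ P_i(τ) P_j(τ) B(σ(τh)) dτ`, the integral of a matrix being taken entrywise. -/
def rhoCoeff (B : EuclideanSpace ℝ (Fin m) → Matrix (Fin m) (Fin m) ℝ) (h : ℝ)
    (σ : ℝ → EuclideanSpace ℝ (Fin m)) (i j : ℕ) : Matrix (Fin m) (Fin m) ℝ :=
  Matrix.of fun k l =>
    ∫ τ in (0 : ℝ)..1, (legendreP i).eval τ * (legendreP j).eval τ * B (σ (τ * h)) k l

/-- `σ` is a path on `[0,h]` of the continuous procedure with `s` terms and step `h` started at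
`y₀`: `σ(0) = y₀` and `σ'(ch) = ∑_{i,j=0}^{s-1} P_i(c) ρ_ij(σ) γ_j(σ)` for `c ∈ [0,1]`, where `σ'`
is the derivative with respect to `t = ch`. The new approximation is `y₁ = σ(h)`. -/
structure IsProcedurePath (H : EuclideanSpace ℝ (Fin m) → ℝ)
    (B : EuclideanSpace ℝ (Fin m) → Matrix (Fin m) (Fin m) ℝ) (s : ℕ)
    (y₀ : EuclideanSpace ℝ (Fin m)) (h : ℝ) (σ : ℝ → EuclideanSpace ℝ (Fin m)) : Prop where
  initial : σ 0 = y₀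
  ode : ∀ c ∈ Set.Icc (0 : ℝ) 1, HasDerivWithinAt σ
    (∑ i ∈ Finset.range s, ∑ j ∈ Finset.range s,
      (legendreP i).eval c • Matrix.toEuclideanLin (rhoCoeff B h σ i j) (gammaCoeff H h σ j))
    (Set.Icc 0 h) (c * h)

end PoissonHBVM

end

/-!
Write `u(c) = σ(ch)` for a path of the procedure in rescaled time, `b = B` for the structure matrix
as an operator, `g = ∇H`, `f = b g`, and `Π = legProj s` for the `L²(0,1)`-orthogonal projection
onto polynomials of degree less than `s`. Since `∑ⱼ Pⱼ γⱼ = Π[g(u)]` and `∑ᵢ Pᵢ ∫ Pᵢ w = Π w`, the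
procedure reads `u' = h Π[b(u) Π[g(u)]]` (`sum_rhoCoeff_gammaCoeff`, `isProcedurePath_iff`).

*Solvability.* Bounds on `K` keep every path in `K` inside a small closed ball around `y₀`, on which
`b` and `g` are Lipschitz. There the Legendre coefficients of `u'` solve a fixed point equation in
finite dimension with contraction factor `O(h)` (`BoundedLipschitzOn.exists_procedure`), and two
paths agree by comparing their derivatives (`BoundedLipschitzOn.procedure_unique`).

*Order.* The residual `r = f(u) - Π[b(u) Π[g(u)]]` splits into the two projection errors
`b(u) (g(u) - Π[g(u)])` and `w - Π w` with `w = b(u) Π[g(u)]`. Smoothness is only ever used along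
the exact solution `y`, where all functions involved are `C^s` and independent of `h`; by Taylor's
formula they are `O(h^s)`-close on `[0,h]` to polynomials of degree less than `s`
(`exists_polyApprox_scale`). Passing from `y` to `u` costs a multiple of `sup ‖u - y‖`, so the
residual is `O(h^s + sup ‖u - y‖)`, whence `u - y = O(h^{s+1})` and both projection errors are
`O(h^s)` (`BoundedLipschitzOn.exists_uniform_error`).

The order is doubled by orthogonality (`BoundedLipschitzOn.exists_local_error`). Linearize `f` along
`y`, `f(x) - f(y) = A (x - y) + ⋯`, and let `Φ' = -Φ A`, `Φ(0) = 1`. With `e = u - y` the derivative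
of `Φ e` is `Φ` applied to the linearization remainder minus `Φ r`. As `A` is `C^{s-1}`, both `Φ`
and `Φ b(y)` are `C^s`, hence `O(h^s)`-close to polynomials of degree less than `s`; against such
weights the projection errors, which are `O(h^s)` and orthogonal to these polynomials, integrate
to `O(h^{2s})` (`PolyApprox.norm_integral_apply_sub_legProj_le`). The remainder is `O(‖e‖²)` for
`s ≥ 2` and `O(‖e‖)` for `s = 1`, in both cases `O(h^{2s})` (`exists_linearization`). The length `h`
of the interval contributes the last factor.
-/

namespace PoissonHBVM

open Set MeasureTheory Polynomial

/-! ### Orthogonal projection onto polynomials of degree less than `s` -/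

section Projection

variable {V W : Type*} [NormedAddCommGroup V] [NormedSpace ℝ V]
  [NormedAddCommGroup W] [NormedSpace ℝ W]

theorem exists_eq_sum_legendreP (s : ℕ) (p : ℝ[X]) (hp : p.degree < s) :
    ∃ a : ℕ → ℝ, p = ∑ i ∈ Finset.range s, C (a i) * legendreP i := by
  induction s generalizing p with
  | zero =>
    refine ⟨0, ?_⟩
    have : p = 0 := by simpa using hp
    simp [this]
  | succ s ih =>
    have hl : (legendreP s).coeff s ≠ 0 :=
      coeff_ne_zero_of_eq_degree (degree_legendreP s)
    set b := p.coeff s / (legendreP s).coeff s with hb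
    have hlt : (p - C b * legendreP s).degree < s := by
      rw [degree_lt_iff_coeff_zero]
      intro k hk
      rcases hk.eq_or_lt with rfl | hk
      · simp [hb, hl]
      · have h1 : p.coeff k = 0 := coeff_eq_zero_of_degree_lt
          (hp.trans_le (by exact_mod_cast hk))
        have h2 : (legendreP s).coeff k = 0 := coeff_eq_zero_of_degree_lt
          (by rw [degree_legendreP]; exact_mod_cast hk)
        simp [h1, h2]
    obtain ⟨a, ha⟩ := ih _ hlt
    refine ⟨fun i => if i = s then b else a i, ?_⟩
    rw [Finset.sum_range_succ]
    simp only [if_true]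
    rw [← sub_eq_iff_eq_add, ha]
    refine Finset.sum_congr rfl fun i hi => ?_
    rw [if_neg (Finset.mem_range.1 hi).ne]

/-- A polynomial of degree less than `s` is the sum of its Legendre series. -/
theorem sum_integral_legendreP (s : ℕ) (p : ℝ[X]) (hp : p.degree < s) (c : ℝ) :
    ∑ i ∈ Finset.range s, (legendreP i).eval c *
      (∫ τ in (0 : ℝ)..1, (legendreP i).eval τ * p.eval τ) = p.eval c := by
  obtain ⟨a, rfl⟩ := exists_eq_sum_legendreP s p hp
  rw [eval_finsetSum]
  refine Finset.sum_congr rfl fun i hi => ?_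
  have : ∫ τ in (0 : ℝ)..1, (legendreP i).eval τ *
      (∑ k ∈ Finset.range s, C (a k) * legendreP k).eval τ = a i := by
    simp only [eval_finsetSum, Finset.mul_sum, eval_mul, eval_C]
    rw [intervalIntegral.integral_finsetSum]
    · rw [Finset.sum_eq_single i]
      · simp only [mul_left_comm]
        rw [intervalIntegral.integral_const_mul, integral_legendreP, if_pos rfl, mul_one]
      · intro k _ hk
        simp only [mul_left_comm]
        rw [intervalIntegral.integral_const_mul, integral_legendreP, if_neg hk.symm, mul_zero]
      · exact fun h => absurd hi h
    · intro k _
      exact (Continuous.intervalIntegrable (by fun_prop) _ _)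
  rw [this, eval_mul, eval_C, mul_comm]

/-- The `L²(0,1)`-orthogonal projection of `w` onto polynomials of degree less than `s`. -/
noncomputable def legProj (s : ℕ) (w : ℝ → V) (c : ℝ) : V :=
  ∑ i ∈ Finset.range s, (legendreP i).eval c • ∫ τ in (0 : ℝ)..1, (legendreP i).eval τ • w τ

/-- `w` is within `D` of a `V`-valued polynomial of degree less than `s`, uniformly on `[0,1]`. -/
def PolyApprox (s : ℕ) (D : ℝ) (w : ℝ → V) : Prop :=
  ∃ a : ℕ → V, ∀ c ∈ Icc (0 : ℝ) 1, ‖w c - ∑ k ∈ Finset.range s, c ^ k • a k‖ ≤ D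

theorem exists_legendreP_bound (s : ℕ) :
    ∃ κ : ℝ, 0 ≤ κ ∧ ∀ i ∈ Finset.range s, ∀ c ∈ Icc (0 : ℝ) 1, |(legendreP i).eval c| ≤ κ := by
  have h : ∀ i : ℕ, ∃ M : ℝ, ∀ c ∈ Icc (0 : ℝ) 1, |(legendreP i).eval c| ≤ M := fun i => by
    simpa using isCompact_Icc.exists_bound_of_continuousOn
      (s := Icc (0 : ℝ) 1) (legendreP i).continuous.continuousOn
  choose M hM using h
  have h0 : ∀ i, 0 ≤ M i := fun i => (abs_nonneg _).trans (hM i 0 (by simp))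
  exact ⟨∑ i ∈ Finset.range s, M i, Finset.sum_nonneg fun i _ => h0 i, fun i hi c hc =>
    (hM i c hc).trans (Finset.single_le_sum (f := M) (fun i _ => h0 i) hi)⟩

/-- A common bound on `[0,1]` for the Legendre polynomials of degree less than `s`. -/
noncomputable def legSup (s : ℕ) : ℝ := (exists_legendreP_bound s).choose

theorem legSup_nonneg (s : ℕ) : 0 ≤ legSup s := (exists_legendreP_bound s).choose_spec.1

theorem abs_legendreP_le {s i : ℕ} (hi : i ∈ Finset.range s) {c : ℝ} (hc : c ∈ Icc (0 : ℝ) 1) :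
    |(legendreP i).eval c| ≤ legSup s :=
  (exists_legendreP_bound s).choose_spec.2 i hi c hc

/-- A bound for the norm of `legProj s` as an operator on continuous functions. -/
noncomputable def projBound (s : ℕ) : ℝ := s * legSup s ^ 2

theorem projBound_nonneg (s : ℕ) : 0 ≤ projBound s := by unfold projBound; positivity

theorem intervalIntegrable_of_continuousOn_Icc {V : Type*} [NormedAddCommGroup V]
    {w : ℝ → V} (hw : ContinuousOn w (Icc 0 1)) :
    IntervalIntegrable w volume 0 1 :=
  ContinuousOn.intervalIntegrable_of_Icc zero_le_one hw

theorem norm_integral_le_of_Icc {w : ℝ → V} {D : ℝ} (hw : ∀ c ∈ Icc (0 : ℝ) 1, ‖w c‖ ≤ D) :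
    ‖∫ τ in (0 : ℝ)..1, w τ‖ ≤ D := by
  have := intervalIntegral.norm_integral_le_of_norm_le_const (a := (0 : ℝ)) (b := 1) (f := w)
    (C := D) (fun x hx => hw x (by rw [uIoc_of_le zero_le_one] at hx; exact ⟨hx.1.le, hx.2⟩))
  simpa using this

theorem norm_integral_legendreP_smul_le {s i : ℕ} (hi : i ∈ Finset.range s) {w : ℝ → V} {D : ℝ}
    (hw : ∀ c ∈ Icc (0 : ℝ) 1, ‖w c‖ ≤ D) :
    ‖∫ τ in (0 : ℝ)..1, (legendreP i).eval τ • w τ‖ ≤ legSup s * D := by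
  refine norm_integral_le_of_Icc fun c hc => ?_
  rw [norm_smul]
  exact mul_le_mul (abs_legendreP_le hi hc) (hw c hc) (norm_nonneg _) (legSup_nonneg s)

theorem norm_sum_legendreP_smul_le {s : ℕ} {q : ℕ → V} {Q : ℝ}
    (hq : ∀ i ∈ Finset.range s, ‖q i‖ ≤ Q) {c : ℝ} (hc : c ∈ Icc (0 : ℝ) 1) :
    ‖∑ i ∈ Finset.range s, (legendreP i).eval c • q i‖ ≤ s * (legSup s * Q) := by
  refine (norm_sum_le_of_le _ (n := fun _ => legSup s * Q) fun i hi => ?_).trans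
    (by simp)
  rw [norm_smul]
  exact mul_le_mul (abs_legendreP_le hi hc) (hq i hi) (norm_nonneg _) (legSup_nonneg s)

theorem norm_legProj_le {s : ℕ} {w : ℝ → V} {D : ℝ}
    (hw : ∀ c ∈ Icc (0 : ℝ) 1, ‖w c‖ ≤ D) {c : ℝ} (hc : c ∈ Icc (0 : ℝ) 1) :
    ‖legProj s w c‖ ≤ projBound s * D := by
  refine (norm_sum_legendreP_smul_le
    (fun i hi => norm_integral_legendreP_smul_le hi hw) hc).trans (le_of_eq ?_)
  rw [projBound]; ring

theorem continuous_legProj (s : ℕ) (w : ℝ → V) : Continuous (legProj s w) := by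
  unfold legProj
  fun_prop

theorem continuousOn_eval_smul (p : ℝ[X]) {w : ℝ → V} {S : Set ℝ} (hw : ContinuousOn w S) :
    ContinuousOn (fun τ => p.eval τ • w τ) S :=
  p.continuous.continuousOn.smul hw

theorem legProj_sub {s : ℕ} {w v : ℝ → V} (hw : ContinuousOn w (Icc 0 1))
    (hv : ContinuousOn v (Icc 0 1)) (c : ℝ) :
    legProj s (fun τ => w τ - v τ) c = legProj s w c - legProj s v c := by
  simp only [legProj, smul_sub, ← Finset.sum_sub_distrib]
  refine Finset.sum_congr rfl fun i _ => ?_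
  rw [intervalIntegral.integral_sub
    (intervalIntegrable_of_continuousOn_Icc (continuousOn_eval_smul _ hw))
    (intervalIntegrable_of_continuousOn_Icc (continuousOn_eval_smul _ hv)), smul_sub]

theorem PolyApprox.mono {s : ℕ} {D D' : ℝ} {w : ℝ → V} (h : PolyApprox s D w) (hD : D ≤ D') :
    PolyApprox s D' w :=
  let ⟨a, ha⟩ := h
  ⟨a, fun c hc => (ha c hc).trans hD⟩

theorem PolyApprox.add_of_norm_sub_le {s : ℕ} {D ε : ℝ} {w v : ℝ → V} (h : PolyApprox s D w)
    (hv : ∀ c ∈ Icc (0 : ℝ) 1, ‖v c - w c‖ ≤ ε) : PolyApprox s (D + ε) v := by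
  obtain ⟨a, ha⟩ := h
  refine ⟨a, fun c hc => ?_⟩
  calc _ = ‖(w c - ∑ k ∈ Finset.range s, c ^ k • a k) + (v c - w c)‖ := by congr 1; abel
    _ ≤ _ := (norm_add_le _ _).trans (add_le_add (ha c hc) (hv c hc))

/-- Rescaling a `C^s` function to a step of length `h` makes it an `O(h^s)`-near-polynomial. -/
theorem exists_polyApprox_scale {s : ℕ} (hs : 1 ≤ s) {T : ℝ} (hT : 0 ≤ T) {F : ℝ → V}
    (hF : ContDiffOn ℝ s F (Icc 0 T)) :
    ∃ C : ℝ, 0 ≤ C ∧ ∀ h ∈ Icc 0 T, PolyApprox s (C * h ^ s) fun c => F (c * h) := by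
  obtain ⟨n, rfl⟩ : ∃ n, s = n + 1 := ⟨s - 1, by omega⟩
  obtain ⟨C, hC⟩ := exists_taylor_mean_remainder_bound (n := n) hT (by exact_mod_cast hF)
  refine ⟨max C 0, le_max_right _ _, fun h hh => ⟨fun k => ((k.factorial : ℝ)⁻¹ * h ^ k) •
    iteratedDerivWithin k F (Icc 0 T) 0, fun c hc => ?_⟩⟩
  have hch : c * h ∈ Icc 0 T := ⟨mul_nonneg hc.1 hh.1,
    (mul_le_of_le_one_left hh.1 hc.2).trans hh.2⟩
  have h1 := hC _ hch
  rw [taylor_within_apply] at h1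
  have e : ∑ k ∈ Finset.range (n + 1), c ^ k • (((k.factorial : ℝ)⁻¹ * h ^ k) •
      iteratedDerivWithin k F (Icc 0 T) 0) = ∑ k ∈ Finset.range (n + 1),
      ((k.factorial : ℝ)⁻¹ * (c * h - 0) ^ k) • iteratedDerivWithin k F (Icc 0 T) 0 := by
    refine Finset.sum_congr rfl fun k _ => ?_
    rw [smul_smul]
    congr 1
    rw [sub_zero, mul_pow]; ring
  rw [e]
  refine h1.trans ?_
  rw [sub_zero]
  exact mul_le_mul (le_max_left _ _)
    (pow_le_pow_left₀ hch.1 (mul_le_of_le_one_left hh.1 hc.2) _)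
    (pow_nonneg hch.1 _) (le_max_right _ _)

variable [CompleteSpace V] [CompleteSpace W]

/-- The projection reproduces polynomials of degree less than `s`. -/
theorem legProj_poly (s : ℕ) (a : ℕ → V) (c : ℝ) :
    legProj s (fun τ => ∑ k ∈ Finset.range s, τ ^ k • a k) c =
      ∑ k ∈ Finset.range s, c ^ k • a k := by
  have h1 : ∀ i, ∫ τ in (0 : ℝ)..1, (legendreP i).eval τ • ∑ k ∈ Finset.range s, τ ^ k • a k =
      ∑ k ∈ Finset.range s, (∫ τ in (0 : ℝ)..1, (legendreP i).eval τ * (X ^ k : ℝ[X]).eval τ)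
        • a k := by
    intro i
    simp only [Finset.smul_sum, smul_smul, eval_pow, eval_X]
    rw [intervalIntegral.integral_finsetSum]
    · refine Finset.sum_congr rfl fun k _ => ?_
      rw [intervalIntegral.integral_smul_const]
    · intro k _
      exact Continuous.intervalIntegrable (by fun_prop) _ _
  simp only [legProj, h1]
  simp only [Finset.smul_sum, smul_smul]
  rw [Finset.sum_comm]
  refine Finset.sum_congr rfl fun k hk => ?_
  rw [← Finset.sum_smul, sum_integral_legendreP s (X ^ k)
    (by rw [degree_X_pow]; exact_mod_cast Finset.mem_range.1 hk)]
  simp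

/-- `w - legProj s w` is orthogonal to polynomials of degree less than `s`. -/
theorem integral_pow_smul_sub_legProj {s k : ℕ} (hk : k < s) {w : ℝ → V}
    (hw : ContinuousOn w (Icc 0 1)) :
    ∫ τ in (0 : ℝ)..1, τ ^ k • (w τ - legProj s w τ) = 0 := by
  have hkw : IntervalIntegrable (fun τ : ℝ => τ ^ k • w τ) volume 0 1 :=
    intervalIntegrable_of_continuousOn_Icc ((continuous_pow k).continuousOn.smul hw)
  have hp : ∫ τ in (0 : ℝ)..1, τ ^ k • legProj s w τ = ∫ τ in (0 : ℝ)..1, τ ^ k • w τ := by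
    have h1 : ∀ i, (∫ τ in (0 : ℝ)..1, τ ^ k * (legendreP i).eval τ) •
        (∫ τ in (0 : ℝ)..1, (legendreP i).eval τ • w τ) =
        ∫ τ in (0 : ℝ)..1, ((legendreP i).eval τ *
          ∫ x in (0 : ℝ)..1, (legendreP i).eval x * (X ^ k : ℝ[X]).eval x) • w τ := by
      intro i
      rw [← intervalIntegral.integral_smul]
      refine intervalIntegral.integral_congr fun τ _ => ?_
      simp only [smul_smul, eval_pow, eval_X]
      rw [mul_comm]
      simp only [mul_comm]
    simp only [legProj, Finset.smul_sum, smul_smul]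
    rw [intervalIntegral.integral_finsetSum
      (fun i _ => Continuous.intervalIntegrable (by fun_prop) _ _)]
    simp only [intervalIntegral.integral_smul_const, h1]
    rw [← intervalIntegral.integral_finsetSum]
    · refine intervalIntegral.integral_congr fun τ _ => ?_
      rw [← Finset.sum_smul, sum_integral_legendreP s (X ^ k)
        (by rw [degree_X_pow]; exact_mod_cast hk) τ, eval_pow, eval_X]
    · intro i _
      exact intervalIntegrable_of_continuousOn_Icc
        (((legendreP i).continuous.mul continuous_const).continuousOn.smul hw)
  simp only [smul_sub]
  rw [intervalIntegral.integral_sub hkw, hp, sub_self]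
  exact ((continuous_pow k).smul (continuous_legProj s w)).intervalIntegrable _ _

/-- Near-polynomials are nearly reproduced by the projection. -/
theorem PolyApprox.norm_sub_legProj_le {s : ℕ} {D : ℝ} {w : ℝ → V} (h : PolyApprox s D w)
    (hw : ContinuousOn w (Icc 0 1)) {c : ℝ} (hc : c ∈ Icc (0 : ℝ) 1) :
    ‖w c - legProj s w c‖ ≤ (1 + projBound s) * D := by
  obtain ⟨a, ha⟩ := h
  have h1 := norm_legProj_le (s := s) ha hc
  rw [legProj_sub hw (by fun_prop), legProj_poly] at h1
  calc ‖w c - legProj s w c‖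
      = ‖(w c - ∑ k ∈ Finset.range s, c ^ k • a k) -
          (legProj s w c - ∑ k ∈ Finset.range s, c ^ k • a k)‖ := by congr 1; abel
    _ ≤ D + projBound s * D := (norm_sub_le _ _).trans (add_le_add (ha c hc) h1)
    _ = _ := by ring

/-- Integrating the projection error against a near-polynomial operator gains both factors. -/
theorem PolyApprox.norm_integral_apply_sub_legProj_le {s : ℕ} {D D' : ℝ} {L : ℝ → V →L[ℝ] W}
    (h : PolyApprox s D L) (hL : ContinuousOn L (Icc 0 1)) {w : ℝ → V}
    (hw : ContinuousOn w (Icc 0 1))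
    (hD' : ∀ c ∈ Icc (0 : ℝ) 1, ‖w c - legProj s w c‖ ≤ D') :
    ‖∫ τ in (0 : ℝ)..1, L τ (w τ - legProj s w τ)‖ ≤ D * D' := by
  obtain ⟨a, ha⟩ := h
  have hr : ContinuousOn (fun τ => w τ - legProj s w τ) (Icc 0 1) :=
    hw.sub (continuous_legProj s w).continuousOn
  have h0 : ∫ τ in (0 : ℝ)..1, (∑ k ∈ Finset.range s, τ ^ k • a k) (w τ - legProj s w τ) = 0 := by
    simp only [sum_apply, smul_apply]
    rw [intervalIntegral.integral_finsetSum]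
    · refine Finset.sum_eq_zero fun k hk => ?_
      simp only [← map_smul]
      rw [ContinuousLinearMap.intervalIntegral_comp_comm,
        integral_pow_smul_sub_legProj (Finset.mem_range.1 hk) hw, map_zero]
      exact intervalIntegrable_of_continuousOn_Icc ((continuous_pow k).continuousOn.smul hr)
    · intro k _
      exact intervalIntegrable_of_continuousOn_Icc
        ((continuous_pow k).continuousOn.smul ((a k).continuous.comp_continuousOn hr))
  have hp : ContinuousOn (fun τ : ℝ => ∑ k ∈ Finset.range s, τ ^ k • a k) (Icc 0 1) := by
    fun_prop
  rw [← sub_zero (∫ τ in (0 : ℝ)..1, L τ (w τ - legProj s w τ)), ← h0,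
    ← intervalIntegral.integral_sub
      (intervalIntegrable_of_continuousOn_Icc (hL.clm_apply hr))
      (intervalIntegrable_of_continuousOn_Icc (hp.clm_apply hr))]
  simp only [← sub_apply]
  refine norm_integral_le_of_Icc fun c hc => ?_
  exact (ContinuousLinearMap.le_opNorm _ _).trans (mul_le_mul (ha c hc) (hD' c hc)
    (norm_nonneg _) ((norm_nonneg _).trans (ha c hc)))

end Projection

/-! ### Local error of the projected procedure -/

section LocalError

variable {E : Type*} [NormedAddCommGroup E] [NormedSpace ℝ E]

/-- The coefficient maps `b` and `g` are bounded by `M` and `L`-Lipschitz on `X`. -/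
structure BoundedLipschitzOn (b : E → E →L[ℝ] E) (g : E → E) (X : Set E) (M L : ℝ) : Prop where
  norm_b : ∀ x ∈ X, ‖b x‖ ≤ M
  norm_g : ∀ x ∈ X, ‖g x‖ ≤ M
  lip_b : ∀ x ∈ X, ∀ x' ∈ X, ‖b x - b x'‖ ≤ L * ‖x - x'‖
  lip_g : ∀ x ∈ X, ∀ x' ∈ X, ‖g x - g x'‖ ≤ L * ‖x - x'‖
  nonneg_M : 0 ≤ M
  nonneg_L : 0 ≤ L

theorem continuousOn_of_norm_sub_le {V W : Type*} [NormedAddCommGroup V] [NormedAddCommGroup W]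
    {F : V → W} {X : Set V} {L : ℝ} (h : ∀ x ∈ X, ∀ x' ∈ X, ‖F x - F x'‖ ≤ L * ‖x - x'‖) :
    ContinuousOn F X :=
  (LipschitzOnWith.of_dist_le_mul (K := L.toNNReal) fun x hx x' hx' => by
    rw [dist_eq_norm, dist_eq_norm]
    exact (h x hx x' hx').trans
      (mul_le_mul_of_nonneg_right (Real.le_coe_toNNReal L) (norm_nonneg _))).continuousOn

variable {b : E → E →L[ℝ] E} {g : E → E} {X : Set E} {M L : ℝ}

theorem BoundedLipschitzOn.lip_apply (H : BoundedLipschitzOn b g X M L) {x x' : E} (hx : x ∈ X)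
    (hx' : x' ∈ X) : ‖b x (g x) - b x' (g x')‖ ≤ 2 * M * L * ‖x - x'‖ := by
  calc ‖b x (g x) - b x' (g x')‖ = ‖b x (g x - g x') + (b x - b x') (g x')‖ := by
        congr 1
        rw [map_sub, sub_apply]
        abel
    _ ≤ M * (L * ‖x - x'‖) + (L * ‖x - x'‖) * M := by
        refine (norm_add_le _ _).trans (add_le_add ?_ ?_)
        · exact (ContinuousLinearMap.le_opNorm _ _).trans (mul_le_mul (H.norm_b x hx)
            (H.lip_g x hx x' hx') (norm_nonneg _) H.nonneg_M)
        · exact (ContinuousLinearMap.le_opNorm _ _).trans (mul_le_mul (H.lip_b x hx x' hx')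
            (H.norm_g x' hx') (norm_nonneg _) (mul_nonneg H.nonneg_L (norm_nonneg _)))
    _ = _ := by ring

theorem BoundedLipschitzOn.continuousOn_b (H : BoundedLipschitzOn b g X M L) : ContinuousOn b X :=
  continuousOn_of_norm_sub_le H.lip_b

theorem BoundedLipschitzOn.continuousOn_g (H : BoundedLipschitzOn b g X M L) : ContinuousOn g X :=
  continuousOn_of_norm_sub_le H.lip_g

/-- The integrand `b(u) Π[g(u)]` of the coefficients of the procedure, `Π = legProj s`. -/
noncomputable def innerField (b : E → E →L[ℝ] E) (g : E → E) (s : ℕ) (u : ℝ → E) (c : ℝ) : E :=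
  b (u c) (legProj s (fun τ => g (u τ)) c)

/-- The field `Π[b(u) Π[g(u)]]` of the procedure along the rescaled path `u(c) = σ(ch)`. -/
noncomputable def procField (b : E → E →L[ℝ] E) (g : E → E) (s : ℕ) (u : ℝ → E) (c : ℝ) : E :=
  legProj s (innerField b g s u) c

theorem BoundedLipschitzOn.continuousOn_innerField (H : BoundedLipschitzOn b g X M L) {s : ℕ}
    {u : ℝ → E} (hu : ContinuousOn u (Icc 0 1)) (huX : MapsTo u (Icc 0 1) X) :
    ContinuousOn (innerField b g s u) (Icc 0 1) :=
  (H.continuousOn_b.comp hu huX).clm_apply (continuous_legProj _ _).continuousOn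

variable [CompleteSpace E]

/-- If `g` and `b g` are `δ`-close to polynomials of degree less than `s` along `z`, and `u` is
`ε`-close to `z`, then both projection errors made along `u` are `O(δ + ε)`. -/
theorem BoundedLipschitzOn.exists_projection_error (H : BoundedLipschitzOn b g X M L) (s : ℕ) :
    ∃ Q : ℝ, 0 ≤ Q ∧ ∀ (u z : ℝ → E) (δ ε : ℝ), 0 ≤ δ → ContinuousOn u (Icc 0 1) →
      MapsTo u (Icc 0 1) X → MapsTo z (Icc 0 1) X →
      PolyApprox s δ (fun c => g (z c)) → PolyApprox s δ (fun c => b (z c) (g (z c))) →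
      (∀ c ∈ Icc (0 : ℝ) 1, ‖u c - z c‖ ≤ ε) → ∀ c ∈ Icc (0 : ℝ) 1,
      ‖g (u c) - legProj s (fun τ => g (u τ)) c‖ ≤ Q * (δ + ε) ∧
      ‖innerField b g s u c - procField b g s u c‖ ≤ Q * (δ + ε) := by
  have hM := H.nonneg_M
  have hL := H.nonneg_L
  have hκ := projBound_nonneg s
  set κ := projBound s
  refine ⟨(1 + κ) * (1 + L) + (1 + κ) * (1 + 2 * M * L + M * ((1 + κ) * (1 + L))),
    by positivity, fun u z δ ε hδ hu huX hzX hg hf hε => ?_⟩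
  have hε0 : 0 ≤ ε := (norm_nonneg _).trans (hε 0 (by simp))
  have hgu : ContinuousOn (fun c => g (u c)) (Icc 0 1) := H.continuousOn_g.comp hu huX
  have h1 : ∀ c ∈ Icc (0 : ℝ) 1, ‖g (u c) - legProj s (fun τ => g (u τ)) c‖ ≤
      (1 + κ) * (1 + L) * (δ + ε) := by
    intro c hc
    refine (PolyApprox.norm_sub_legProj_le (hg.add_of_norm_sub_le (ε := L * ε)
      fun c hc => ?_) hgu hc).trans ?_
    · exact (H.lip_g _ (huX hc) _ (hzX hc)).trans (mul_le_mul_of_nonneg_left (hε c hc) hL)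
    · rw [mul_assoc]
      refine mul_le_mul_of_nonneg_left ?_ (by positivity)
      nlinarith [mul_nonneg hL hδ]
  intro c hc
  constructor
  · refine (h1 c hc).trans (mul_le_mul_of_nonneg_right ?_ (by positivity))
    exact le_add_of_nonneg_right (by positivity)
  · refine (PolyApprox.norm_sub_legProj_le (hf.add_of_norm_sub_le (v := innerField b g s u)
      (ε := 2 * M * L * ε + M * ((1 + κ) * (1 + L) * (δ + ε))) fun c hc => ?_)
      (H.continuousOn_innerField hu huX) hc).trans ?_
    · have e : innerField b g s u c - b (z c) (g (z c)) =
          (b (u c) (g (u c)) - b (z c) (g (z c))) -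
            b (u c) (g (u c) - legProj s (fun τ => g (u τ)) c) := by
        rw [innerField, map_sub]; abel
      rw [e]
      refine (norm_sub_le _ _).trans (add_le_add ?_ ?_)
      · exact (H.lip_apply (huX hc) (hzX hc)).trans
          (mul_le_mul_of_nonneg_left (hε c hc) (by positivity))
      · exact (ContinuousLinearMap.le_opNorm _ _).trans (mul_le_mul (H.norm_b _ (huX hc))
          (h1 c hc) (norm_nonneg _) hM)
    · rw [add_mul ((1 + κ) * (1 + L))]
      have h0 : 0 ≤ (1 + κ) * (1 + L) * (δ + ε) := by positivity
      refine le_trans ?_ (le_add_of_nonneg_left h0)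
      rw [mul_assoc (1 + κ) (1 + 2 * M * L + M * ((1 + κ) * (1 + L))) (δ + ε)]
      refine mul_le_mul_of_nonneg_left ?_ (by positivity)
      have : 0 ≤ M * L * δ := by positivity
      nlinarith

theorem mapsTo_mul_Icc {T h : ℝ} (hh : h ∈ Icc 0 T) :
    MapsTo (fun c : ℝ => c * h) (Icc 0 1) (Icc 0 T) :=
  fun _ hx => ⟨mul_nonneg hx.1 hh.1, (mul_le_of_le_one_left hh.1 hx.2).trans hh.2⟩

theorem hasDerivWithinAt_rescale {V : Type*} [NormedAddCommGroup V] [NormedSpace ℝ V]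
    {F : ℝ → V} {F' : V} {T h c : ℝ} (hh : h ∈ Icc 0 T)
    (hF : HasDerivWithinAt F F' (Icc 0 T) (c * h)) :
    HasDerivWithinAt (fun c => F (c * h)) (h • F') (Icc 0 1) c := by
  have h1 : HasDerivWithinAt (fun c : ℝ => c * h) h (Icc 0 1) c := by
    simpa using (hasDerivWithinAt_id c (Icc (0 : ℝ) 1)).mul_const h
  exact HasDerivWithinAt.scomp c hF h1 (mapsTo_mul_Icc hh)

/-- The crude error bound: the path of the procedure is within `O(h^{s+1})` of the solution. -/
theorem BoundedLipschitzOn.exists_uniform_error (H : BoundedLipschitzOn b g X M L) {s : ℕ}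
    (hs : 1 ≤ s) {T : ℝ} (hT : 0 < T) {y : ℝ → E} (hyX : MapsTo y (Icc 0 T) X)
    (hode : ∀ t ∈ Icc 0 T, HasDerivWithinAt y (b (y t) (g (y t))) (Icc 0 T) t)
    (hg : ContDiffOn ℝ s (fun t => g (y t)) (Icc 0 T))
    (hf : ContDiffOn ℝ s (fun t => b (y t) (g (y t))) (Icc 0 T)) :
    ∃ h₁ ∈ Ioc 0 T, ∃ C : ℝ, 0 ≤ C ∧ ∀ h ∈ Ioc 0 h₁, ∀ u : ℝ → E, u 0 = y 0 →
      MapsTo u (Icc 0 1) X →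
      (∀ c ∈ Icc (0 : ℝ) 1, HasDerivWithinAt u (h • procField b g s u c) (Icc 0 1) c) →
      (∀ c ∈ Icc (0 : ℝ) 1, ‖u c - y (c * h)‖ ≤ C * h ^ (s + 1)) ∧
      (∀ c ∈ Icc (0 : ℝ) 1, ‖g (u c) - legProj s (fun τ => g (u τ)) c‖ ≤ C * h ^ s) ∧
      (∀ c ∈ Icc (0 : ℝ) 1, ‖innerField b g s u c - procField b g s u c‖ ≤ C * h ^ s) := by
  have hM := H.nonneg_M
  have hL := H.nonneg_L
  obtain ⟨Q, hQ, hproj⟩ := H.exists_projection_error s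
  obtain ⟨C₁, hC₁, hg'⟩ := exists_polyApprox_scale hs hT.le hg
  obtain ⟨C₂, hC₂, hf'⟩ := exists_polyApprox_scale hs hT.le hf
  set D := C₁ + C₂ with hD
  have hD0 : 0 ≤ D := by positivity
  -- `‖u' - z'‖ ≤ h R (D h^s + ε)`, where `z(c) = y(ch)` and `ε = sup ‖u - z‖`
  set R := M * Q + Q + 2 * M * L with hR
  have hR0 : 0 ≤ R := by positivity
  -- with `h R ≤ 1/2` the term in `ε` is absorbed on the left
  set h₁ := min T (1 / (2 * R + 1)) with hh₁
  have hh₁0 : 0 < h₁ := by positivity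
  refine ⟨h₁, ⟨hh₁0, min_le_left _ _⟩, 2 * R * D + Q * (D + D), by positivity,
    fun h hh u hu0 huX hu => ?_⟩
  have hhT : h ∈ Icc 0 T := ⟨hh.1.le, hh.2.trans (min_le_left _ _)⟩
  have hhR : h * R ≤ 1 / 2 := by
    have h2 : h ≤ 1 / (2 * R + 1) := hh.2.trans (min_le_right _ _)
    rw [le_div_iff₀ (by positivity)] at h2
    nlinarith [hh.1]
  have hh0 := hh.1
  have hpow : 0 < h ^ s := by positivity
  set z : ℝ → E := fun c => y (c * h) with hz
  have hzX : MapsTo z (Icc 0 1) X := hyX.comp (mapsTo_mul_Icc hhT)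
  have hz' : ∀ c ∈ Icc (0 : ℝ) 1, HasDerivWithinAt z (h • b (z c) (g (z c))) (Icc 0 1) c :=
    fun c hc => hasDerivWithinAt_rescale hhT (hode _ (mapsTo_mul_Icc hhT hc))
  have hucont : ContinuousOn u (Icc 0 1) := fun c hc => (hu c hc).continuousWithinAt
  have hzcont : ContinuousOn z (Icc 0 1) := fun c hc => (hz' c hc).continuousWithinAt
  obtain ⟨c₀, hc₀, hmax⟩ := isCompact_Icc.exists_isMaxOn (s := Icc (0 : ℝ) 1)
    ⟨0, by simp⟩ (hucont.sub hzcont).norm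
  set ε := ‖u c₀ - z c₀‖ with hε
  have hεle : ∀ c ∈ Icc (0 : ℝ) 1, ‖u c - z c‖ ≤ ε := fun c hc => hmax hc
  have hε0 : 0 ≤ ε := norm_nonneg _
  have hP := hproj u z (D * h ^ s) ε (by positivity) hucont huX hzX
    ((hg' h hhT).mono (by gcongr; linarith)) ((hf' h hhT).mono (by gcongr; linarith)) hεle
  have hder : ∀ c ∈ Icc (0 : ℝ) 1, HasDerivWithinAt (fun c => u c - z c)
      (h • procField b g s u c - h • b (z c) (g (z c))) (Icc 0 1) c :=
    fun c hc => (hu c hc).sub (hz' c hc)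
  have hbd : ∀ c ∈ Ico (0 : ℝ) 1,
      ‖h • procField b g s u c - h • b (z c) (g (z c))‖ ≤ h * (R * (D * h ^ s + ε)) := by
    intro c hc
    have hc := Ico_subset_Icc_self hc
    rw [← smul_sub, norm_smul, Real.norm_of_nonneg hh0.le]
    refine mul_le_mul_of_nonneg_left ?_ hh0.le
    have e : procField b g s u c - b (z c) (g (z c)) =
        (b (u c) (g (u c)) - b (z c) (g (z c))) -
          b (u c) (g (u c) - legProj s (fun τ => g (u τ)) c) -
          (innerField b g s u c - procField b g s u c) := by
      rw [innerField, map_sub]; abel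
    rw [e]
    have i1 := (H.lip_apply (huX hc) (hzX hc)).trans
          (mul_le_mul_of_nonneg_left (hεle c hc) (by positivity))
    have i2 := (ContinuousLinearMap.le_opNorm (b (u c))
      (g (u c) - legProj s (fun τ => g (u τ)) c)).trans (mul_le_mul (H.norm_b _ (huX hc))
          (hP c hc).1 (norm_nonneg _) hM)
    have i3 := norm_sub_le ((b (u c) (g (u c)) - b (z c) (g (z c))) -
          b (u c) (g (u c) - legProj s (fun τ => g (u τ)) c))
          (innerField b g s u c - procField b g s u c)
    have i4 := norm_sub_le (b (u c) (g (u c)) - b (z c) (g (z c)))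
          (b (u c) (g (u c) - legProj s (fun τ => g (u τ)) c))
    have i5 := (hP c hc).2
    have i6 : 0 ≤ 2 * M * L * (D * h ^ s) := by positivity
    rw [hR]
    linarith
  have hmain := norm_image_sub_le_of_norm_deriv_le_segment' hder hbd c₀ hc₀
  have e0 : u 0 - z 0 = 0 := by simp [hz, hu0]
  rw [e0, sub_zero, sub_zero] at hmain
  have hε1 : ε ≤ h * (R * (D * h ^ s + ε)) := hmain.trans
    (mul_le_of_le_one_right (by positivity) hc₀.2)
  have hε2 : ε ≤ 2 * R * D * h ^ (s + 1) := by
    have : h * R * ε ≤ 1 / 2 * ε := mul_le_mul_of_nonneg_right hhR hε0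
    rw [pow_succ]
    nlinarith
  have hεs : ε ≤ D * h ^ s := by
    have : (h * R) * (D * h ^ s) ≤ 1 / 2 * (D * h ^ s) :=
      mul_le_mul_of_nonneg_right hhR (by positivity)
    rw [pow_succ] at hε2
    nlinarith
  have hQD : Q * (D * h ^ s + ε) ≤ (2 * R * D + Q * (D + D)) * h ^ s := by
    have h1 : Q * ε ≤ Q * (D * h ^ s) := mul_le_mul_of_nonneg_left hεs hQ
    have h2 : 0 ≤ 2 * R * D * h ^ s := by positivity
    nlinarith
  refine ⟨fun c hc => ?_, fun c hc => ((hP c hc).1).trans hQD,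
    fun c hc => ((hP c hc).2).trans hQD⟩
  refine (hεle c hc).trans (hε2.trans ?_)
  gcongr
  exact le_add_of_nonneg_right (by positivity)

/-- An antiderivative gains one order of differentiability. -/
theorem contDiffOn_succ_of_hasDerivWithinAt {V : Type*} [NormedAddCommGroup V] [NormedSpace ℝ V]
    {F F' : ℝ → V} {T : ℝ} (hT : 0 < T) {n : ℕ}
    (hF : ∀ t ∈ Icc 0 T, HasDerivWithinAt F (F' t) (Icc 0 T) t)
    (hF' : ContDiffOn ℝ n F' (Icc 0 T)) : ContDiffOn ℝ ((n + 1 : ℕ) : WithTop ℕ∞) F (Icc 0 T) := by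
  have hu : UniqueDiffOn ℝ (Icc 0 T) := uniqueDiffOn_Icc hT
  push_cast
  rw [contDiffOn_succ_iff_derivWithin hu]
  refine ⟨fun t ht => (hF t ht).differentiableWithinAt, by simp, hF'.congr fun t ht => ?_⟩
  exact (hF t ht).derivWithin (hu t ht)

/-- The solution of the adjoint equation `Φ' = -Φ A`, `Φ(0) = 1`, near `0`. It gains one
derivative over `A`. -/
theorem exists_adjoint_solution {A : ℝ → E →L[ℝ] E} {T : ℝ} (hT : 0 < T) {n : ℕ}
    (hA : ContDiffOn ℝ n A (Icc 0 T)) :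
    ∃ T' ∈ Ioc 0 T, ∃ Φ : ℝ → E →L[ℝ] E,
      (∀ t ∈ Icc 0 T', HasDerivWithinAt Φ (-(Φ t ∘L A t)) (Icc 0 T') t) ∧
      ContDiffOn ℝ ((n + 1 : ℕ) : WithTop ℕ∞) Φ (Icc 0 T') ∧
      ∀ t ∈ Icc 0 T', ‖Φ t - 1‖ ≤ 1 / 2 := by
  obtain ⟨M₀, hM₀⟩ := isCompact_Icc.exists_bound_of_continuousOn hA.continuousOn
  have hM₀0 : 0 ≤ M₀ := (norm_nonneg _).trans (hM₀ 0 ⟨le_rfl, hT.le⟩)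
  lift M₀ to NNReal using hM₀0
  -- on the unit ball around `1` the field is bounded by `2 M₀`, so the time `1 / (2 M₀)` is enough
  set T₁ := min T (1 / (2 * M₀ + 1)) with hT₁
  have hT₁0 : 0 < T₁ := by positivity
  have hsub : Icc 0 T₁ ⊆ Icc 0 T := Icc_subset_Icc_right (min_le_left _ _)
  set F : ℝ → (E →L[ℝ] E) → (E →L[ℝ] E) := fun t x => -(x ∘L A t) with hF
  have hPL : IsPicardLindelof F (tmin := 0) (tmax := T₁) ⟨0, le_rfl, hT₁0.le⟩
      (1 : E →L[ℝ] E) 1 0 (2 * M₀) M₀ := by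
    refine ⟨fun t ht => LipschitzOnWith.of_dist_le_mul fun x _ x' _ => ?_, fun x _ => ?_,
      fun t ht x hx => ?_, ?_⟩
    · rw [dist_eq_norm, dist_eq_norm]
      have : F t x - F t x' = -((x - x') ∘L A t) := by
        simp only [hF, ContinuousLinearMap.sub_comp]; abel
      rw [this, norm_neg, mul_comm]
      exact (ContinuousLinearMap.opNorm_comp_le _ _).trans
        (mul_le_mul_of_nonneg_left (hM₀ t (hsub ht)) (norm_nonneg _))
    · exact (continuousOn_const.clm_comp (hA.continuousOn.mono hsub)).neg
    · rw [norm_neg]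
      refine (ContinuousLinearMap.opNorm_comp_le _ _).trans ?_
      refine mul_le_mul ?_ (hM₀ t (hsub ht)) (norm_nonneg _) (by norm_num)
      have h1 : ‖x - 1‖ ≤ 1 := by simpa [dist_eq_norm] using hx
      have h2 : ‖(1 : E →L[ℝ] E)‖ ≤ 1 := ContinuousLinearMap.norm_id_le
      calc ‖x‖ = ‖(x - 1) + 1‖ := by simp
        _ ≤ 1 + 1 := (norm_add_le _ _).trans (add_le_add h1 h2)
        _ = _ := by norm_num
    · have h2 : T₁ ≤ 1 / (2 * M₀ + 1) := min_le_right _ _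
      rw [le_div_iff₀ (by positivity)] at h2
      simp only [sub_zero, sub_self, max_eq_left hT₁0.le]
      push_cast
      nlinarith
  obtain ⟨Φ, hΦ0, hΦ⟩ := hPL.exists_eq_forall_mem_Icc_hasDerivWithinAt₀
  have hΦn : ContDiffOn ℝ n Φ (Icc 0 T₁) := by
    refine ODE.contDiffOn_enat_Icc_of_hasDerivWithinAt (n := n) (f := F) (u := univ) ?_ hΦ
      (mapsTo_univ _ _)
    have : ContDiffOn ℝ n (fun p : ℝ × (E →L[ℝ] E) => A p.1) (Icc 0 T₁ ×ˢ univ) :=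
      (hA.mono hsub).comp contDiffOn_fst fun p hp => hp.1
    exact (contDiffOn_snd.clm_comp this).neg
  -- the right-hand side `-Φ A` is `C^n`, so `Φ` is `C^{n+1}`
  have hΦn1 : ContDiffOn ℝ ((n + 1 : ℕ) : WithTop ℕ∞) Φ (Icc 0 T₁) :=
    contDiffOn_succ_of_hasDerivWithinAt hT₁0 hΦ (hΦn.clm_comp (hA.mono hsub)).neg
  have hcont : ContinuousWithinAt Φ (Icc 0 T₁) 0 :=
    (hΦ 0 ⟨le_rfl, hT₁0.le⟩).continuousWithinAt
  obtain ⟨δ, hδ, hδ'⟩ := Metric.continuousWithinAt_iff.1 hcont (1 / 2) (by norm_num)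
  have hΦ0' : Φ 0 = 1 := hΦ0
  refine ⟨min T₁ (δ / 2), ⟨by positivity, (min_le_left _ _).trans (min_le_left _ _)⟩, Φ,
    fun t ht => ?_, hΦn1.mono (Icc_subset_Icc_right (min_le_left _ _)), fun t ht => ?_⟩
  · exact (hΦ t ⟨ht.1, ht.2.trans (min_le_left _ _)⟩).mono
      (Icc_subset_Icc_right (min_le_left _ _))
  · have := hδ' (x := t) ⟨ht.1, ht.2.trans (min_le_left _ _)⟩ (by
      rw [Real.dist_eq, sub_zero, abs_of_nonneg ht.1]
      have := ht.2.trans (min_le_right _ _)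
      linarith)
    rw [hΦ0', dist_eq_norm] at this
    exact this.le

/-- The local error is `O(h^{2s+1})`: the error, transported by the adjoint solution `Φ`, is an
integral of the residual against near-polynomials, to which the residual is nearly orthogonal.
The hypothesis `hlin` is the linearization of the field along the solution, with a remainder of
order `p` such that `(s + 1) p ≥ 2 s`. -/
theorem BoundedLipschitzOn.exists_local_error (H : BoundedLipschitzOn b g X M L) {s : ℕ}
    (hs : 1 ≤ s) {T : ℝ} (hT : 0 < T) {y : ℝ → E} (hyX : MapsTo y (Icc 0 T) X)
    (hode : ∀ t ∈ Icc 0 T, HasDerivWithinAt y (b (y t) (g (y t))) (Icc 0 T) t)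
    (hg : ContDiffOn ℝ s (fun t => g (y t)) (Icc 0 T))
    (hb : ContDiffOn ℝ s (fun t => b (y t)) (Icc 0 T))
    {A : ℝ → E →L[ℝ] E} (hA : ContDiffOn ℝ ((s - 1 : ℕ) : WithTop ℕ∞) A (Icc 0 T))
    {p : ℕ} (hp : 2 * s ≤ (s + 1) * p) {C₀ : ℝ} (hC₀ : 0 ≤ C₀)
    (hlin : ∀ t ∈ Icc 0 T, ∀ x ∈ X,
      ‖b x (g x) - b (y t) (g (y t)) - A t (x - y t)‖ ≤ C₀ * ‖x - y t‖ ^ p) :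
    ∃ h₁ ∈ Ioc 0 T, ∃ C : ℝ, ∀ h ∈ Ioc 0 h₁, ∀ u : ℝ → E, u 0 = y 0 →
      MapsTo u (Icc 0 1) X →
      (∀ c ∈ Icc (0 : ℝ) 1, HasDerivWithinAt u (h • procField b g s u c) (Icc 0 1) c) →
      ‖u 1 - y h‖ ≤ C * h ^ (2 * s + 1) := by
  have hM := H.nonneg_M
  have hL := H.nonneg_L
  have hf : ContDiffOn ℝ s (fun t => b (y t) (g (y t))) (Icc 0 T) := hb.clm_apply hg
  obtain ⟨h₁, hh₁, C, hC, hcrude⟩ := H.exists_uniform_error hs hT hyX hode hg hf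
  obtain ⟨T', hT', Φ, hΦ', hΦs, hΦ1⟩ := exists_adjoint_solution hT hA
  rw [Nat.sub_add_cancel hs] at hΦs
  have hsub : Icc 0 T' ⊆ Icc 0 T := Icc_subset_Icc_right hT'.2
  obtain ⟨C₃, hC₃, hΦpoly⟩ := exists_polyApprox_scale hs hT'.1.le hΦs
  obtain ⟨C₄, hC₄, hΦbpoly⟩ := exists_polyApprox_scale hs hT'.1.le (hΦs.clm_comp (hb.mono hsub))
  have hΦ2 : ∀ t ∈ Icc 0 T', ‖Φ t‖ ≤ 2 := fun t ht => by
    have h2 : ‖(1 : E →L[ℝ] E)‖ ≤ 1 := ContinuousLinearMap.norm_id_le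
    calc ‖Φ t‖ = ‖(Φ t - 1) + 1‖ := by simp
      _ ≤ 1 / 2 + 1 := (norm_add_le _ _).trans (add_le_add (hΦ1 t ht) h2)
      _ ≤ 2 := by norm_num
  refine ⟨min (min h₁ T') 1, ⟨lt_min (lt_min hh₁.1 hT'.1) one_pos,
    (min_le_left _ _).trans ((min_le_right _ _).trans hT'.2)⟩,
    2 * (2 * (C₀ * C ^ p) + (C₄ + 2 * (L * C)) * C + C₃ * C), fun h hh u hu0 huX hu => ?_⟩
  have hh0 := hh.1
  have hh1 : h ≤ 1 := hh.2.trans (min_le_right _ _)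
  have hhT' : h ∈ Icc 0 T' := ⟨hh0.le, hh.2.trans ((min_le_left _ _).trans (min_le_right _ _))⟩
  have hhT : h ∈ Icc 0 T := hsub hhT'
  obtain ⟨herr, hgerr, hferr⟩ :=
    hcrude h ⟨hh0, hh.2.trans ((min_le_left _ _).trans (min_le_left _ _))⟩ u hu0 huX hu
  have hz' : ∀ c ∈ Icc (0 : ℝ) 1, HasDerivWithinAt (fun c => y (c * h))
      (h • b (y (c * h)) (g (y (c * h)))) (Icc 0 1) c :=
    fun c hc => hasDerivWithinAt_rescale hhT (hode _ (mapsTo_mul_Icc hhT hc))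
  have hΨ' : ∀ c ∈ Icc (0 : ℝ) 1, HasDerivWithinAt (fun c => Φ (c * h))
      (h • -(Φ (c * h) ∘L A (c * h))) (Icc 0 1) c :=
    fun c hc => hasDerivWithinAt_rescale hhT' (hΦ' _ (mapsTo_mul_Icc hhT' hc))
  have hucont : ContinuousOn u (Icc 0 1) := fun c hc => (hu c hc).continuousWithinAt
  have hzcont : ContinuousOn (fun c => y (c * h)) (Icc 0 1) :=
    fun c hc => (hz' c hc).continuousWithinAt
  have hΨcont : ContinuousOn (fun c => Φ (c * h)) (Icc 0 1) :=
    fun c hc => (hΨ' c hc).continuousWithinAt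
  have hAcont : ContinuousOn (fun c => A (c * h)) (Icc 0 1) :=
    hA.continuousOn.comp (by fun_prop) (mapsTo_mul_Icc hhT)
  have hzX : MapsTo (fun c => y (c * h)) (Icc 0 1) X := hyX.comp (mapsTo_mul_Icc hhT)
  have hbu : ContinuousOn (fun c => b (u c)) (Icc 0 1) := H.continuousOn_b.comp hucont huX
  have hgu : ContinuousOn (fun c => g (u c)) (Icc 0 1) := H.continuousOn_g.comp hucont huX
  have hbz : ContinuousOn (fun c => b (y (c * h))) (Icc 0 1) :=
    H.continuousOn_b.comp hzcont hzX
  have hgz : ContinuousOn (fun c => g (y (c * h))) (Icc 0 1) :=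
    H.continuousOn_g.comp hzcont hzX
  have hw := H.continuousOn_innerField (s := s) hucont huX
  -- the remainder of the linearization and the two parts of the residual
  set N : ℝ → E := fun c => Φ (c * h) (b (u c) (g (u c)) - b (y (c * h)) (g (y (c * h))) -
    A (c * h) (u c - y (c * h))) with hN
  set r₁ : ℝ → E := fun c => (Φ (c * h) ∘L b (u c))
    (g (u c) - legProj s (fun τ => g (u τ)) c) with hr₁
  set r₂ : ℝ → E := fun c => Φ (c * h)
    (innerField b g s u c - legProj s (innerField b g s u) c) with hr₂
  have hNc : ContinuousOn N (Icc 0 1) := hΨcont.clm_apply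
    (((hbu.clm_apply hgu).sub (hbz.clm_apply hgz)).sub (hAcont.clm_apply (hucont.sub hzcont)))
  have hr₁c : ContinuousOn r₁ (Icc 0 1) := (hΨcont.clm_comp hbu).clm_apply
    (hgu.sub (continuous_legProj _ _).continuousOn)
  have hr₂c : ContinuousOn r₂ (Icc 0 1) := hΨcont.clm_apply
    (hw.sub (continuous_legProj _ _).continuousOn)
  have hNr : ContinuousOn (fun c => N c - r₁ c) (Icc 0 1) := hNc.sub hr₁c
  have hder : ∀ c ∈ Icc (0 : ℝ) 1, HasDerivWithinAt (fun c => Φ (c * h) (u c - y (c * h)))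
      (h • (N c - r₁ c - r₂ c)) (Icc 0 1) c := by
    intro c hc
    refine ((hΨ' c hc).clm_apply ((hu c hc).sub (hz' c hc))).congr_deriv ?_
    simp only [hN, hr₁, hr₂, innerField, procField, smul_apply, neg_apply, map_sub, map_smul,
      ContinuousLinearMap.comp_apply, smul_sub, smul_neg,
      Pi.sub_apply]
    abel
  have hFTC : ∫ c in (0 : ℝ)..1, h • (N c - r₁ c - r₂ c) = Φ h (u 1 - y h) := by
    rw [intervalIntegral.integral_eq_sub_of_hasDerivAt_of_le zero_le_one
      (fun c hc => (hder c hc).continuousWithinAt)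
      (fun c hc => (hder c (Ioo_subset_Icc_self hc)).hasDerivAt (Icc_mem_nhds hc.1 hc.2))
      (intervalIntegrable_of_continuousOn_Icc ((hNr.sub hr₂c).const_smul h))]
    simp [hu0]
  rw [intervalIntegral.integral_smul, intervalIntegral.integral_sub
    (intervalIntegrable_of_continuousOn_Icc hNr)
    (intervalIntegrable_of_continuousOn_Icc hr₂c), intervalIntegral.integral_sub
    (intervalIntegrable_of_continuousOn_Icc hNc)
    (intervalIntegrable_of_continuousOn_Icc hr₁c)] at hFTC
  have hpow : (h ^ s) * (h ^ s) = h ^ (2 * s) := by rw [← pow_add, two_mul]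
  have hI0 : ‖∫ c in (0 : ℝ)..1, N c‖ ≤ 2 * (C₀ * C ^ p) * h ^ (2 * s) := by
    refine norm_integral_le_of_Icc fun c hc => ?_
    refine (ContinuousLinearMap.le_opNorm _ _).trans ?_
    rw [mul_assoc]
    refine mul_le_mul (hΦ2 _ (mapsTo_mul_Icc hhT' hc)) ?_ (norm_nonneg _) (by norm_num)
    refine (hlin _ (mapsTo_mul_Icc hhT hc) _ (huX hc)).trans ?_
    rw [mul_assoc]
    refine mul_le_mul_of_nonneg_left ?_ hC₀
    calc ‖u c - y (c * h)‖ ^ p ≤ (C * h ^ (s + 1)) ^ p :=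
          pow_le_pow_left₀ (norm_nonneg _) (herr c hc) p
      _ = C ^ p * h ^ ((s + 1) * p) := by rw [mul_pow, ← pow_mul]
      _ ≤ C ^ p * h ^ (2 * s) := mul_le_mul_of_nonneg_left
          (pow_le_pow_of_le_one hh0.le hh1 hp) (by positivity)
  -- `Φ b(u)` differs from the `C^s` function `Φ b(y)` by `O(h^{s+1})`
  have hI1 : ‖∫ c in (0 : ℝ)..1, r₁ c‖ ≤ (C₄ + 2 * (L * C)) * C * h ^ (2 * s) := by
    have hpoly : PolyApprox s (C₄ * h ^ s + 2 * (L * (C * h ^ (s + 1))))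
        (fun c => Φ (c * h) ∘L b (u c)) := by
      refine (hΦbpoly h hhT').add_of_norm_sub_le fun c hc => ?_
      rw [← ContinuousLinearMap.comp_sub]
      refine (ContinuousLinearMap.opNorm_comp_le _ _).trans ?_
      refine mul_le_mul (hΦ2 _ (mapsTo_mul_Icc hhT' hc)) ?_ (norm_nonneg _) (by norm_num)
      exact (H.lip_b _ (huX hc) _ (hzX hc)).trans (mul_le_mul_of_nonneg_left (herr c hc) hL)
    refine (hpoly.norm_integral_apply_sub_legProj_le (hΨcont.clm_comp hbu) hgu hgerr).trans ?_
    have h1 : h ^ (s + 1) ≤ h ^ s := pow_le_pow_of_le_one hh0.le hh1 (Nat.le_succ s)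
    calc (C₄ * h ^ s + 2 * (L * (C * h ^ (s + 1)))) * (C * h ^ s)
        ≤ (C₄ * h ^ s + 2 * (L * (C * h ^ s))) * (C * h ^ s) := by gcongr
      _ = _ := by rw [← hpow]; ring
  have hI2 : ‖∫ c in (0 : ℝ)..1, r₂ c‖ ≤ C₃ * C * h ^ (2 * s) := by
    refine ((hΦpoly h hhT').norm_integral_apply_sub_legProj_le hΨcont hw hferr).trans
      (le_of_eq ?_)
    rw [← hpow]; ring
  have hfin : ‖Φ h (u 1 - y h)‖ ≤
      h * ((2 * (C₀ * C ^ p) + (C₄ + 2 * (L * C)) * C + C₃ * C) * h ^ (2 * s)) := by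
    rw [← hFTC, norm_smul, Real.norm_of_nonneg hh0.le]
    refine mul_le_mul_of_nonneg_left ?_ hh0.le
    have i1 := norm_sub_le ((∫ c in (0 : ℝ)..1, N c) - ∫ c in (0 : ℝ)..1, r₁ c)
      (∫ c in (0 : ℝ)..1, r₂ c)
    have i2 := norm_sub_le (∫ c in (0 : ℝ)..1, N c) (∫ c in (0 : ℝ)..1, r₁ c)
    linarith
  -- `Φ h` is within `1/2` of the identity
  have hinv : ‖u 1 - y h‖ ≤ ‖Φ h (u 1 - y h)‖ + 1 / 2 * ‖u 1 - y h‖ := by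
    calc ‖u 1 - y h‖ = ‖Φ h (u 1 - y h) - (Φ h - 1) (u 1 - y h)‖ := by
          congr 1; simp
      _ ≤ _ := (norm_sub_le _ _).trans (add_le_add le_rfl
          ((ContinuousLinearMap.le_opNorm _ _).trans
            (mul_le_mul_of_nonneg_right (hΦ1 h hhT') (norm_nonneg _))))
  rw [pow_succ]
  linarith

end LocalError

/-! ### Solvability of the procedure -/

section Solvability

variable {E : Type*} [NormedAddCommGroup E] [NormedSpace ℝ E]
variable {b : E → E →L[ℝ] E} {g : E → E} {X : Set E} {M L : ℝ}

theorem norm_innerField_le {s : ℕ} (hM : 0 ≤ M) (hb : ∀ x ∈ X, ‖b x‖ ≤ M)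
    (hg : ∀ x ∈ X, ‖g x‖ ≤ M) {u : ℝ → E} (huX : MapsTo u (Icc 0 1) X) {c : ℝ}
    (hc : c ∈ Icc (0 : ℝ) 1) : ‖innerField b g s u c‖ ≤ M * (projBound s * M) :=
  (ContinuousLinearMap.le_opNorm _ _).trans (mul_le_mul (hb _ (huX hc))
    (norm_legProj_le (fun _ hτ => hg _ (huX hτ)) hc) (norm_nonneg _) hM)

/-- Paths of the procedure stay close to their initial value. -/
theorem norm_sub_le_of_procField {s : ℕ} (hM : 0 ≤ M) (hb : ∀ x ∈ X, ‖b x‖ ≤ M)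
    (hg : ∀ x ∈ X, ‖g x‖ ≤ M) {h : ℝ} (hh : 0 ≤ h) {u : ℝ → E} (huX : MapsTo u (Icc 0 1) X)
    (hu : ∀ c ∈ Icc (0 : ℝ) 1, HasDerivWithinAt u (h • procField b g s u c) (Icc 0 1) c)
    {c : ℝ} (hc : c ∈ Icc (0 : ℝ) 1) :
    ‖u c - u 0‖ ≤ h * (projBound s * (M * (projBound s * M))) := by
  have hκ := projBound_nonneg s
  refine (norm_image_sub_le_of_norm_deriv_le_segment' hu
    (C := h * (projBound s * (M * (projBound s * M)))) (fun c hc => ?_) c hc).trans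
    (mul_le_of_le_one_right (by positivity) (by linarith [hc.2]))
  rw [norm_smul, Real.norm_of_nonneg hh]
  exact mul_le_mul_of_nonneg_left (norm_legProj_le
    (fun τ hτ => norm_innerField_le hM hb hg huX hτ) (Ico_subset_Icc_self hc)) hh

theorem BoundedLipschitzOn.norm_innerField_sub_le (H : BoundedLipschitzOn b g X M L) {s : ℕ}
    {u v : ℝ → E} (hu : ContinuousOn u (Icc 0 1)) (hv : ContinuousOn v (Icc 0 1))
    (huX : MapsTo u (Icc 0 1) X) (hvX : MapsTo v (Icc 0 1) X) {ε : ℝ}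
    (hε : ∀ c ∈ Icc (0 : ℝ) 1, ‖u c - v c‖ ≤ ε) {c : ℝ} (hc : c ∈ Icc (0 : ℝ) 1) :
    ‖innerField b g s u c - innerField b g s v c‖ ≤ 2 * M * L * projBound s * ε := by
  have hM := H.nonneg_M
  have hL := H.nonneg_L
  have hκ := projBound_nonneg s
  have hε0 : 0 ≤ ε := (norm_nonneg _).trans (hε c hc)
  have hgsub : ‖legProj s (fun τ => g (u τ)) c - legProj s (fun τ => g (v τ)) c‖ ≤
      projBound s * (L * ε) := by
    rw [← legProj_sub (w := fun τ => g (u τ)) (v := fun τ => g (v τ))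
      (H.continuousOn_g.comp hu huX) (H.continuousOn_g.comp hv hvX)]
    exact norm_legProj_le (fun τ hτ => (H.lip_g _ (huX hτ) _ (hvX hτ)).trans
      (mul_le_mul_of_nonneg_left (hε τ hτ) hL)) hc
  calc ‖innerField b g s u c - innerField b g s v c‖
      = ‖b (u c) (legProj s (fun τ => g (u τ)) c - legProj s (fun τ => g (v τ)) c) +
          (b (u c) - b (v c)) (legProj s (fun τ => g (v τ)) c)‖ := by
        congr 1
        rw [innerField, innerField, map_sub, sub_apply]
        abel
    _ ≤ M * (projBound s * (L * ε)) + (L * ε) * (projBound s * M) := by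
        refine (norm_add_le _ _).trans (add_le_add ?_ ?_)
        · exact (ContinuousLinearMap.le_opNorm _ _).trans
            (mul_le_mul (H.norm_b _ (huX hc)) hgsub (norm_nonneg _) hM)
        · exact (ContinuousLinearMap.le_opNorm _ _).trans
            (mul_le_mul ((H.lip_b _ (huX hc) _ (hvX hc)).trans
              (mul_le_mul_of_nonneg_left (hε c hc) hL))
              (norm_legProj_le (fun τ hτ => H.norm_g _ (hvX hτ)) hc) (norm_nonneg _)
              (mul_nonneg hL hε0))
    _ = _ := by ring

/-- For small steps two paths of the procedure with the same initial value agree. -/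
theorem BoundedLipschitzOn.procedure_unique (H : BoundedLipschitzOn b g X M L) {s : ℕ} {h : ℝ}
    (hh : 0 < h) (hsmall : h * (projBound s * (2 * M * L * projBound s)) ≤ 1 / 2) {u v : ℝ → E}
    (h0 : u 0 = v 0) (huX : MapsTo u (Icc 0 1) X) (hvX : MapsTo v (Icc 0 1) X)
    (hu : ∀ c ∈ Icc (0 : ℝ) 1, HasDerivWithinAt u (h • procField b g s u c) (Icc 0 1) c)
    (hv : ∀ c ∈ Icc (0 : ℝ) 1, HasDerivWithinAt v (h • procField b g s v c) (Icc 0 1) c) :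
    EqOn u v (Icc 0 1) := by
  have hM := H.nonneg_M
  have hL := H.nonneg_L
  have hκ := projBound_nonneg s
  have hucont : ContinuousOn u (Icc 0 1) := fun c hc => (hu c hc).continuousWithinAt
  have hvcont : ContinuousOn v (Icc 0 1) := fun c hc => (hv c hc).continuousWithinAt
  obtain ⟨c₀, hc₀, hmax⟩ := isCompact_Icc.exists_isMaxOn (s := Icc (0 : ℝ) 1)
    ⟨0, by simp⟩ (hucont.sub hvcont).norm
  set ε := ‖u c₀ - v c₀‖ with hε
  have hεle : ∀ c ∈ Icc (0 : ℝ) 1, ‖u c - v c‖ ≤ ε := fun c hc => hmax hc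
  have hε0 : 0 ≤ ε := norm_nonneg _
  have hmain := norm_image_sub_le_of_norm_deriv_le_segment'
    (C := h * (projBound s * (2 * M * L * projBound s * ε)))
    (fun c hc => (hu c hc).sub (hv c hc)) (fun c hc => by
      rw [← smul_sub, norm_smul, Real.norm_of_nonneg hh.le, procField, procField,
        ← legProj_sub (H.continuousOn_innerField hucont huX) (H.continuousOn_innerField hvcont hvX)]
      exact mul_le_mul_of_nonneg_left (norm_legProj_le (fun τ hτ =>
        H.norm_innerField_sub_le hucont hvcont huX hvX hεle hτ) (Ico_subset_Icc_self hc)) hh.le)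
      c₀ hc₀
  have e0 : (u - v) 0 = 0 := by simp [h0]
  rw [e0, sub_zero, sub_zero] at hmain
  have hmain' : ε ≤ h * (projBound s * (2 * M * L * projBound s * ε)) :=
    hmain.trans (mul_le_of_le_one_right (by positivity) hc₀.2)
  have : ε ≤ 0 := by
    have := mul_le_mul_of_nonneg_right hsmall hε0
    nlinarith
  intro c hc
  exact sub_eq_zero.1 (norm_le_zero_iff.1 ((hεle c hc).trans this))

/-- The path `c ↦ y₀ + h ∑ᵢ (∫₀ᶜ Pᵢ) qᵢ` with Legendre coefficients `q` of its derivative. -/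
noncomputable def coeffPath (s : ℕ) (y₀ : E) (h : ℝ) (q : Fin s → E) (c : ℝ) : E :=
  y₀ + h • ∑ i : Fin s, (∫ τ in (0 : ℝ)..c, (legendreP i).eval τ) • q i

theorem hasDerivAt_coeffPath (s : ℕ) (y₀ : E) (h : ℝ) (q : Fin s → E) (c : ℝ) :
    HasDerivAt (coeffPath s y₀ h q) (h • ∑ i : Fin s, (legendreP i).eval c • q i) c := by
  refine HasDerivAt.const_add _ (HasDerivAt.const_smul h (HasDerivAt.fun_sum fun i _ => ?_))
  exact ((legendreP i).continuous.integral_hasStrictDerivAt 0 c).hasDerivAt.smul_const _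

theorem norm_coeffPath_sub_le (s : ℕ) (y₀ : E) {h : ℝ} (hh : 0 ≤ h) (q q' : Fin s → E) {c : ℝ}
    (hc : c ∈ Icc (0 : ℝ) 1) :
    ‖coeffPath s y₀ h q c - coeffPath s y₀ h q' c‖ ≤ h * (s * (legSup s * ‖q - q'‖)) := by
  rw [coeffPath, coeffPath, add_sub_add_left_eq_sub, ← smul_sub, ← Finset.sum_sub_distrib,
    norm_smul, Real.norm_of_nonneg hh]
  refine mul_le_mul_of_nonneg_left ?_ hh
  refine (norm_sum_le_of_le _ (n := fun _ => legSup s * ‖q - q'‖) fun i _ => ?_).trans (by simp)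
  rw [← smul_sub, norm_smul]
  refine mul_le_mul ?_ (norm_le_pi_norm (q - q') i) (norm_nonneg _) (legSup_nonneg s)
  have := intervalIntegral.norm_integral_le_of_norm_le_const (a := (0 : ℝ)) (b := c)
    (f := fun τ => (legendreP i).eval τ) (C := legSup s) (fun x hx => by
      rw [uIoc_of_le hc.1] at hx
      exact abs_legendreP_le (Finset.mem_range.2 i.2) ⟨hx.1.le, hx.2.trans hc.2⟩)
  refine this.trans (mul_le_of_le_one_right (legSup_nonneg s) ?_)
  rw [sub_zero, abs_of_nonneg hc.1]
  exact hc.2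

variable [CompleteSpace E]

/-- For small steps the procedure has a path in the closed ball, by the contraction principle for
the Legendre coefficients of the derivative. -/
theorem BoundedLipschitzOn.exists_procedure {y₀ : E} {R : ℝ}
    (H : BoundedLipschitzOn b g (Metric.closedBall y₀ R) M L) {s : ℕ} {h : ℝ} (hh : 0 < h)
    (hball : h * (projBound s * (M * (projBound s * M))) ≤ R)
    (hsmall : h * (projBound s * (2 * M * L * projBound s)) ≤ 1 / 2) :
    ∃ u : ℝ → E, u 0 = y₀ ∧ MapsTo u (Icc 0 1) (Metric.closedBall y₀ R) ∧
      ∀ c ∈ Icc (0 : ℝ) 1, HasDerivWithinAt u (h • procField b g s u c) (Icc 0 1) c := by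
  have hM := H.nonneg_M
  have hL := H.nonneg_L
  have hκ := projBound_nonneg s
  have hS := legSup_nonneg s
  have hκS : projBound s = s * (legSup s * legSup s) := by rw [projBound, sq]
  set κ := projBound s
  -- a bound for the Legendre coefficients of `innerField` along any path in the ball
  set Q₀ := legSup s * (M * (κ * M)) with hQ₀
  have hQ₀0 : 0 ≤ Q₀ := by positivity
  set u : (Fin s → E) → ℝ → E := coeffPath s y₀ h with hudef
  set F : (Fin s → E) → Fin s → E := fun q i =>
    ∫ τ in (0 : ℝ)..1, (legendreP i).eval τ • innerField b g s (u q) τ with hF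
  have hu0 : ∀ q, u q 0 = y₀ := fun q => by simp [hudef, coeffPath]
  have hucont : ∀ q, ContinuousOn (u q) (Icc 0 1) := fun q c _ =>
    (hasDerivAt_coeffPath s y₀ h q c).continuousAt.continuousWithinAt
  have huX : ∀ q ∈ Metric.closedBall (0 : Fin s → E) Q₀,
      MapsTo (u q) (Icc 0 1) (Metric.closedBall y₀ R) := by
    intro q hq c hc
    have hq' : ‖q‖ ≤ Q₀ := by simpa using hq
    have h1 := norm_coeffPath_sub_le s y₀ hh.le q 0 hc
    have h2 : coeffPath s y₀ h (0 : Fin s → E) c = y₀ := by simp [coeffPath]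
    rw [h2, sub_zero] at h1
    rw [Metric.mem_closedBall, dist_eq_norm]
    refine h1.trans (le_trans ?_ hball)
    refine mul_le_mul_of_nonneg_left ?_ hh.le
    calc s * (legSup s * ‖q‖) ≤ s * (legSup s * Q₀) := by gcongr
      _ = κ * (M * (κ * M)) := by rw [hQ₀]; nth_rewrite 2 [hκS]; ring
  have hFX : MapsTo F (Metric.closedBall 0 Q₀) (Metric.closedBall 0 Q₀) := by
    intro q hq
    rw [mem_closedBall_zero_iff, pi_norm_le_iff_of_nonneg hQ₀0]
    intro i
    exact norm_integral_legendreP_smul_le (Finset.mem_range.2 i.2) fun c hc =>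
      norm_innerField_le hM H.norm_b H.norm_g (huX q hq) hc
  have hlip : ContractingWith (1 / 2) (hFX.restrict F _ _) := by
    refine ⟨by
      rw [← NNReal.coe_lt_coe]
      norm_num, LipschitzWith.of_dist_le_mul fun q q' => ?_⟩
    rw [Subtype.dist_eq, Subtype.dist_eq, dist_eq_norm, dist_eq_norm]
    simp only [MapsTo.val_restrict_apply]
    rw [pi_norm_le_iff_of_nonneg (by positivity)]
    intro i
    rw [Pi.sub_apply]
    simp only [hF]
    rw [← intervalIntegral.integral_sub
      (intervalIntegrable_of_continuousOn_Icc (continuousOn_eval_smul _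
        (H.continuousOn_innerField (hucont _) (huX _ q.2))))
      (intervalIntegrable_of_continuousOn_Icc (continuousOn_eval_smul _
        (H.continuousOn_innerField (hucont _) (huX _ q'.2))))]
    simp only [← smul_sub]
    refine (norm_integral_legendreP_smul_le (Finset.mem_range.2 i.2) fun c hc =>
      H.norm_innerField_sub_le (hucont _) (hucont _) (huX _ q.2) (huX _ q'.2)
        (fun c hc => norm_coeffPath_sub_le s y₀ hh.le _ _ hc) hc).trans ?_
    have e : legSup s * (2 * M * L * κ * (h * (s * (legSup s * ‖(q : Fin s → E) - q'‖)))) =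
        h * (κ * (2 * M * L * κ)) * ‖(q : Fin s → E) - q'‖ := by
      nth_rewrite 2 [hκS]; ring
    rw [e]
    refine mul_le_mul_of_nonneg_right (hsmall.trans (by norm_num)) (norm_nonneg _)
  obtain ⟨q, hq, hfix, -⟩ := ContractingWith.exists_fixedPoint'
    (Metric.isClosed_closedBall.isComplete) hFX hlip
    (Metric.mem_closedBall_self hQ₀0) (edist_ne_top _ _)
  refine ⟨u q, hu0 q, huX q hq, fun c _ => ?_⟩
  refine (hasDerivAt_coeffPath s y₀ h q c).hasDerivWithinAt.congr_deriv ?_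
  congr 1
  rw [procField, legProj, Finset.sum_range]
  refine Finset.sum_congr rfl fun i _ => ?_
  rw [← congrFun hfix i]

end Solvability

/-! ### Regularity of the coefficients -/

section Regularity

variable {E F : Type*} [NormedAddCommGroup E] [NormedSpace ℝ E]
  [NormedAddCommGroup F] [NormedSpace ℝ F]

/-- A `C^s` map has a `C^{s-1}` family `A` of linear approximations whose remainder has an order
`p` with `(s + 1) p ≥ 2 s`. For `s = 1` the choice `A = 0`, `p = 1` suffices. -/
theorem exists_linearization {f : E → F} {U X : Set E} (hU : IsOpen U) (hX : IsCompact X)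
    (hXc : Convex ℝ X) (hXU : X ⊆ U) {s : ℕ} (hs : 1 ≤ s) (hf : ContDiffOn ℝ s f U) :
    ∃ A : E → E →L[ℝ] F, ContDiffOn ℝ ((s - 1 : ℕ) : WithTop ℕ∞) A U ∧
      ∃ p : ℕ, 2 * s ≤ (s + 1) * p ∧ ∃ C : ℝ, 0 ≤ C ∧ ∀ z ∈ X, ∀ x ∈ X,
        ‖f x - f z - A z (x - z)‖ ≤ C * ‖x - z‖ ^ p := by
  rcases hs.eq_or_lt with rfl | hs2
  · obtain ⟨K, hK⟩ := (hf.mono hXU).exists_lipschitzOnWith (by simp) hXc hX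
    refine ⟨0, contDiffOn_const, 1, by norm_num, K, K.2, fun z hz x hx => ?_⟩
    simpa [dist_eq_norm] using hK.dist_le_mul x hx z hz
  · have hf' : ContDiffOn ℝ ((s - 1 : ℕ) : WithTop ℕ∞) (fderiv ℝ f) U :=
      hf.fderiv_of_isOpen hU (by exact_mod_cast (Nat.sub_add_cancel hs).le)
    obtain ⟨K, hK⟩ := (hf'.mono hXU).exists_lipschitzOnWith
      (by exact_mod_cast (Nat.sub_pos_of_lt hs2).ne') hXc hX
    refine ⟨fderiv ℝ f, hf', 2, by omega, K, K.2, fun z hz x hx => ?_⟩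
    have hseg : segment ℝ z x ⊆ X := hXc.segment_subset hz hx
    have hd : ∀ w ∈ segment ℝ z x, HasFDerivWithinAt f (fderiv ℝ f w) (segment ℝ z x) w :=
      fun w hw => ((hf.differentiableOn (by exact_mod_cast (by omega : s ≠ 0)) w
        (hXU (hseg hw))).differentiableAt
        (hU.mem_nhds (hXU (hseg hw)))).hasFDerivAt.hasFDerivWithinAt
    have := (convex_segment z x).norm_image_sub_le_of_norm_hasFDerivWithin_le' hd
      (φ := fderiv ℝ f z) (C := K * ‖x - z‖) (fun w hw => ?_) (left_mem_segment ℝ z x)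
      (right_mem_segment ℝ z x)
    · rw [sq, ← mul_assoc]
      exact this
    · rw [← dist_eq_norm]
      refine (hK.dist_le_mul w (hseg hw) z hz).trans (mul_le_mul_of_nonneg_left ?_ K.2)
      rw [segment_eq_image'] at hw
      obtain ⟨θ, hθ, rfl⟩ := hw
      rw [dist_eq_norm, add_sub_cancel_left, norm_smul, Real.norm_of_nonneg hθ.1]
      exact mul_le_of_le_one_left (norm_nonneg _) hθ.2

/-- `C^1` coefficient maps are bounded and Lipschitz on compact convex sets. -/
theorem exists_boundedLipschitzOn {b : E → E →L[ℝ] E} {g : E → E} {X K : Set E}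
    (hX : IsCompact X) (hXc : Convex ℝ X) (hK : IsCompact K) (hXK : X ⊆ K) {s : ℕ} (hs : 1 ≤ s)
    (hb : ContDiffOn ℝ s b K) (hg : ContDiffOn ℝ s g K) :
    ∃ M L : ℝ, BoundedLipschitzOn b g X M L ∧ (∀ x ∈ K, ‖b x‖ ≤ M) ∧ ∀ x ∈ K, ‖g x‖ ≤ M := by
  have hs0 : (s : WithTop ℕ∞) ≠ 0 := by exact_mod_cast (by omega : s ≠ 0)
  obtain ⟨M₁, hM₁⟩ := hK.exists_bound_of_continuousOn hb.continuousOn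
  obtain ⟨M₂, hM₂⟩ := hK.exists_bound_of_continuousOn hg.continuousOn
  obtain ⟨L₁, hL₁⟩ := (hb.mono hXK).exists_lipschitzOnWith hs0 hXc hX
  obtain ⟨L₂, hL₂⟩ := (hg.mono hXK).exists_lipschitzOnWith hs0 hXc hX
  have h1 : ∀ x ∈ K, ‖b x‖ ≤ max 0 (max M₁ M₂) := fun x hx => (hM₁ x hx).trans (by simp)
  have h2 : ∀ x ∈ K, ‖g x‖ ≤ max 0 (max M₁ M₂) := fun x hx => (hM₂ x hx).trans (by simp)
  refine ⟨max 0 (max M₁ M₂), max L₁ L₂, ⟨fun x hx => h1 x (hXK hx), fun x hx => h2 x (hXK hx),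
    fun x hx x' hx' => ?_, fun x hx x' hx' => ?_, le_max_left _ _, by positivity⟩, h1, h2⟩
  · rw [← dist_eq_norm, ← dist_eq_norm]
    exact (hL₁.dist_le_mul x hx x' hx').trans
      (mul_le_mul_of_nonneg_right (by simp) dist_nonneg)
  · rw [← dist_eq_norm, ← dist_eq_norm]
    exact (hL₂.dist_le_mul x hx x' hx').trans
      (mul_le_mul_of_nonneg_right (by simp) dist_nonneg)

end Regularity

/-! ### The Poisson problem -/

section Poisson

variable {m : ℕ}

/-- The structure matrix `B x` as a continuous linear map of Euclidean space. -/
noncomputable def structureMap (B : EuclideanSpace ℝ (Fin m) → Matrix (Fin m) (Fin m) ℝ)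
    (x : EuclideanSpace ℝ (Fin m)) : EuclideanSpace ℝ (Fin m) →L[ℝ] EuclideanSpace ℝ (Fin m) :=
  LinearMap.toContinuousLinearMap (Matrix.toEuclideanLin (B x))

theorem toEuclideanLin_eq_sum (A : Matrix (Fin m) (Fin m) ℝ) :
    Matrix.toEuclideanLin A =
      ∑ k, ∑ l, A k l • Matrix.toEuclideanLin (Matrix.single k l (1 : ℝ)) := by
  conv_lhs => rw [Matrix.matrix_eq_sum_single A]
  simp only [map_sum, ← map_smul, Matrix.smul_single, smul_eq_mul, mul_one]

theorem contDiffOn_structureMap {U : Set (EuclideanSpace ℝ (Fin m))}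
    {B : EuclideanSpace ℝ (Fin m) → Matrix (Fin m) (Fin m) ℝ} {n : WithTop ℕ∞}
    (hB : ∀ k l, ContDiffOn ℝ n (fun y => B y k l) U) : ContDiffOn ℝ n (structureMap B) U := by
  have e : structureMap B = fun x => ∑ k, ∑ l, B x k l •
      LinearMap.toContinuousLinearMap (Matrix.toEuclideanLin (Matrix.single k l (1 : ℝ))) := by
    funext x
    rw [structureMap, toEuclideanLin_eq_sum]
    simp only [map_sum, map_smul]
  rw [e]
  exact ContDiffOn.sum fun k _ => ContDiffOn.sum fun l _ => (hB k l).smul contDiffOn_const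

theorem contDiffOn_gradient {F : Type*} [NormedAddCommGroup F] [InnerProductSpace ℝ F]
    [CompleteSpace F] {U : Set F} (hU : IsOpen U) {H : F → ℝ} {n : ℕ}
    (hH : ContDiffOn ℝ ((n + 1 : ℕ) : WithTop ℕ∞) H U) : ContDiffOn ℝ n (∇ H) U := by
  have h1 : ContDiffOn ℝ n (fderiv ℝ H) U := hH.fderiv_of_isOpen hU (by push_cast; exact le_rfl)
  exact (InnerProductSpace.toDual ℝ F).symm.contDiff.comp_contDiffOn h1

/-- The entrywise integral `ρ_ij` acts on a vector as the integral of the action. -/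
theorem toEuclideanLin_rhoCoeff_apply {B : EuclideanSpace ℝ (Fin m) → Matrix (Fin m) (Fin m) ℝ}
    {h : ℝ} {σ : ℝ → EuclideanSpace ℝ (Fin m)}
    (hB : ∀ k l, ContinuousOn (fun τ => B (σ (τ * h)) k l) (Icc 0 1)) (i j : ℕ)
    (v : EuclideanSpace ℝ (Fin m)) :
    Matrix.toEuclideanLin (rhoCoeff B h σ i j) v =
      ∫ τ in (0 : ℝ)..1, ((legendreP i).eval τ * (legendreP j).eval τ) •
        structureMap B (σ (τ * h)) v := by
  have hcont : ∀ k l, ContinuousOn (fun τ => ((legendreP i).eval τ * (legendreP j).eval τ *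
      B (σ (τ * h)) k l) • Matrix.toEuclideanLin (Matrix.single k l (1 : ℝ)) v) (Icc 0 1) :=
    fun k l => (((legendreP i).continuous.mul (legendreP j).continuous).continuousOn.mul
      (hB k l)).smul continuousOn_const
  have e : ∀ τ, ((legendreP i).eval τ * (legendreP j).eval τ) • structureMap B (σ (τ * h)) v =
      ∑ k, ∑ l, ((legendreP i).eval τ * (legendreP j).eval τ * B (σ (τ * h)) k l) •
        Matrix.toEuclideanLin (Matrix.single k l (1 : ℝ)) v := by
    intro τ
    rw [structureMap, LinearMap.coe_toContinuousLinearMap', toEuclideanLin_eq_sum]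
    simp only [LinearMap.sum_apply, LinearMap.smul_apply, Finset.smul_sum, smul_smul]
  simp only [e]
  rw [intervalIntegral.integral_finsetSum fun k _ => intervalIntegrable_of_continuousOn_Icc
    (continuousOn_finsetSum _ fun l _ => hcont k l), toEuclideanLin_eq_sum]
  simp only [LinearMap.sum_apply, LinearMap.smul_apply]
  refine Finset.sum_congr rfl fun k _ => ?_
  rw [intervalIntegral.integral_finsetSum fun l _ =>
    intervalIntegrable_of_continuousOn_Icc (hcont k l)]
  refine Finset.sum_congr rfl fun l _ => ?_
  rw [intervalIntegral.integral_smul_const]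
  rfl

/-- The double sum of the procedure is the doubly projected field. -/
theorem sum_rhoCoeff_gammaCoeff {H : EuclideanSpace ℝ (Fin m) → ℝ}
    {B : EuclideanSpace ℝ (Fin m) → Matrix (Fin m) (Fin m) ℝ}
    {h : ℝ} {σ : ℝ → EuclideanSpace ℝ (Fin m)}
    (hB : ∀ k l, ContinuousOn (fun τ => B (σ (τ * h)) k l) (Icc 0 1))
    (hb : ContinuousOn (fun τ => structureMap B (σ (τ * h))) (Icc 0 1)) (s : ℕ) (c : ℝ) :
    ∑ i ∈ Finset.range s, ∑ j ∈ Finset.range s,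
      (legendreP i).eval c • Matrix.toEuclideanLin (rhoCoeff B h σ i j) (gammaCoeff H h σ j) =
    procField (structureMap B) (∇ H) s (fun τ => σ (τ * h)) c := by
  rw [procField, legProj]
  refine Finset.sum_congr rfl fun i _ => ?_
  rw [← Finset.smul_sum]
  congr 1
  simp only [toEuclideanLin_rhoCoeff_apply hB]
  rw [← intervalIntegral.integral_finsetSum]
  · refine intervalIntegral.integral_congr fun τ _ => ?_
    simp only [innerField, legProj, map_sum, map_smul, Finset.smul_sum, smul_smul]
    rfl
  · intro j _
    exact intervalIntegrable_of_continuousOn_Icc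
      (((legendreP i).continuous.mul (legendreP j).continuous).continuousOn.smul
        (hb.clm_apply continuousOn_const))

theorem mapsTo_mul_inv_Icc {h : ℝ} (hh : 0 < h) :
    MapsTo (fun t : ℝ => t * h⁻¹) (Icc 0 h) (Icc 0 1) :=
  fun t ht => ⟨mul_nonneg ht.1 (inv_nonneg.2 hh.le),
    (mul_inv_le_iff₀ hh).2 (by rw [one_mul]; exact ht.2)⟩

/-- In rescaled time, a path of the procedure in a set on which the data are continuous is a path
of the doubly projected field, and conversely. -/
theorem isProcedurePath_iff {H : EuclideanSpace ℝ (Fin m) → ℝ}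
    {B : EuclideanSpace ℝ (Fin m) → Matrix (Fin m) (Fin m) ℝ}
    {K : Set (EuclideanSpace ℝ (Fin m))} (hB : ∀ k l, ContinuousOn (fun y => B y k l) K)
    (hb : ContinuousOn (structureMap B) K) {s : ℕ} {y₀ : EuclideanSpace ℝ (Fin m)} {h : ℝ}
    (hh : 0 < h) {σ : ℝ → EuclideanSpace ℝ (Fin m)} {u : ℝ → EuclideanSpace ℝ (Fin m)}
    (hσu : ∀ c, σ (c * h) = u c) (hu : MapsTo u (Icc 0 1) K) :
    IsProcedurePath H B s y₀ h σ ↔ u 0 = y₀ ∧ ∀ c ∈ Icc (0 : ℝ) 1,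
      HasDerivWithinAt u (h • procField (structureMap B) (∇ H) s u c) (Icc 0 1) c := by
  have hσ : σ = fun t => u (t * h⁻¹) := by
    funext t
    rw [← hσu, inv_mul_cancel_right₀ hh.ne']
  have hu' : (fun c => σ (c * h)) = u := funext hσu
  have h0 : σ 0 = u 0 := by simpa using hσu 0
  have hhh : h ∈ Icc 0 h := ⟨hh.le, le_rfl⟩
  have hsum : ContinuousOn u (Icc 0 1) → ∀ c, ∑ i ∈ Finset.range s, ∑ j ∈ Finset.range s,
      (legendreP i).eval c • Matrix.toEuclideanLin (rhoCoeff B h σ i j) (gammaCoeff H h σ j) =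
      procField (structureMap B) (∇ H) s u c := by
    intro hc c
    rw [sum_rhoCoeff_gammaCoeff, hu']
    · intro k l
      simp only [hσu]
      exact (hB k l).comp hc hu
    · simp only [hσu]
      exact hb.comp hc hu
  constructor
  · intro hp
    have hcont : ContinuousOn u (Icc 0 1) := by
      rw [← hu']
      exact fun c hc => (hasDerivWithinAt_rescale hhh (hp.ode c hc)).continuousWithinAt
    refine ⟨h0.symm.trans hp.initial, fun c hc => ?_⟩
    have := hasDerivWithinAt_rescale hhh (hp.ode c hc)
    rwa [hu', hsum hcont] at this
  · rintro ⟨hu0, hode⟩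
    have hcont : ContinuousOn u (Icc 0 1) := fun c hc => (hode c hc).continuousWithinAt
    refine ⟨h0.trans hu0, fun c hc => ?_⟩
    rw [hsum hcont, hσ]
    have h1 : HasDerivWithinAt (fun t : ℝ => t * h⁻¹) h⁻¹ (Icc 0 h) (c * h) := by
      simpa using (hasDerivWithinAt_id (c * h) (Icc 0 h)).mul_const h⁻¹
    have h2 : c * h * h⁻¹ = c := mul_inv_cancel_right₀ hh.ne' c
    have h3 := HasDerivWithinAt.scomp (c * h) (h := fun t : ℝ => t * h⁻¹)
      (by rw [h2]; exact hode c hc) h1 (mapsTo_mul_inv_Icc hh)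
    rwa [smul_smul, inv_mul_cancel₀ hh.ne', one_smul] at h3

end Poisson

end PoissonHBVM

open PoissonHBVM Set

theorem mainTheorem2 {m : ℕ} (s : ℕ) (hs : 1 ≤ s)
    (U : Set (EuclideanSpace ℝ (Fin m))) (hU : IsOpen U)
    (H : EuclideanSpace ℝ (Fin m) → ℝ)
    (B : EuclideanSpace ℝ (Fin m) → Matrix (Fin m) (Fin m) ℝ)
    (hH : ContDiffOn ℝ ((s + 1 : ℕ) : WithTop ℕ∞) H U)
    (hB : ∀ k l : Fin m, ContDiffOn ℝ (s : WithTop ℕ∞) (fun y => B y k l) U)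
    (hskew : ∀ y ∈ U, (B y)ᵀ = -B y)
    (y₀ : EuclideanSpace ℝ (Fin m)) (T : ℝ) (hT : 0 < T)
    (y : ℝ → EuclideanSpace ℝ (Fin m))
    (hy : PoissonHBVM.IsPoissonSolution U H B y₀ T y)
    (K : Set (EuclideanSpace ℝ (Fin m))) (hK : IsCompact K) (hKU : K ⊆ U)
    (hK0 : y₀ ∈ interior K) :
    ∃ h₀ ∈ Set.Ioc 0 T, ∃ C : ℝ, ∀ h ∈ Set.Ioc 0 h₀,
      (∃ σ : ℝ → EuclideanSpace ℝ (Fin m),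
        PoissonHBVM.IsProcedurePath H B s y₀ h σ ∧ Set.MapsTo σ (Set.Icc 0 h) K) ∧
      (∀ σ σ' : ℝ → EuclideanSpace ℝ (Fin m),
        PoissonHBVM.IsProcedurePath H B s y₀ h σ → Set.MapsTo σ (Set.Icc 0 h) K →
        PoissonHBVM.IsProcedurePath H B s y₀ h σ' → Set.MapsTo σ' (Set.Icc 0 h) K →
        Set.EqOn σ σ' (Set.Icc 0 h)) ∧
      (∀ σ : ℝ → EuclideanSpace ℝ (Fin m),
        PoissonHBVM.IsProcedurePath H B s y₀ h σ → Set.MapsTo σ (Set.Icc 0 h) K →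
        ‖σ h - y h‖ ≤ C * h ^ (2 * s + 1)) := by
  set b := structureMap B with hb_def
  set g := ∇ H with hg_def
  have hbU : ContDiffOn ℝ s b U := contDiffOn_structureMap hB
  have hgU : ContDiffOn ℝ s g U := contDiffOn_gradient hU hH
  have hfU : ContDiffOn ℝ s (fun x => b x (g x)) U := hbU.clm_apply hgU
  have hBK : ∀ k l, ContinuousOn (fun y => B y k l) K := fun k l => (hB k l).continuousOn.mono hKU
  have hbK : ContinuousOn b K := hbU.continuousOn.mono hKU
  -- a closed ball in `K`, on which the data are bounded and Lipschitz
  obtain ⟨R, hR, hRK⟩ := Metric.nhds_basis_closedBall.mem_iff.1 (mem_interior_iff_mem_nhds.1 hK0)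
  set X := Metric.closedBall y₀ R with hX
  have hXc : IsCompact X := isCompact_closedBall y₀ R
  have hXU : X ⊆ U := hRK.trans hKU
  obtain ⟨M, L, hML, hbM, hgM⟩ := exists_boundedLipschitzOn hXc (convex_closedBall y₀ R) hK hRK hs
    (hbU.mono hKU) (hgU.mono hKU)
  have hM := hML.nonneg_M
  have hL := hML.nonneg_L
  obtain ⟨A, hA, p, hp, C₀, hC₀, hlin⟩ :=
    exists_linearization hU hXc (convex_closedBall y₀ R) hXU hs hfU
  -- a time up to which the solution stays in the ball
  have hycont : ContinuousWithinAt y (Icc 0 T) 0 := (hy.ode 0 ⟨le_rfl, hT.le⟩).continuousWithinAt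
  obtain ⟨δ, hδ, hδR⟩ := Metric.continuousWithinAt_iff.1 hycont R hR
  set T₁ := min T (δ / 2) with hT₁
  have hT₁0 : 0 < T₁ := by positivity
  have hsub : Icc 0 T₁ ⊆ Icc 0 T := Icc_subset_Icc_right (min_le_left _ _)
  have hyX : MapsTo y (Icc 0 T₁) X := by
    intro t ht
    have := hδR (hsub ht) (by
      rw [Real.dist_eq, sub_zero, abs_of_nonneg ht.1]
      have := ht.2.trans (min_le_right _ _)
      linarith)
    rw [hy.initial] at this
    exact Metric.ball_subset_closedBall this
  have hyU : MapsTo y (Icc 0 T₁) U := hyX.mono_right hXU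
  have hode : ∀ t ∈ Icc 0 T₁, HasDerivWithinAt y (b (y t) (g (y t))) (Icc 0 T₁) t :=
    fun t ht => (hy.ode t (hsub ht)).mono hsub
  have hys : ContDiffOn ℝ s y (Icc 0 T₁) := by
    refine ODE.contDiffOn_enat_Icc_of_hasDerivWithinAt (n := s) (f := fun _ x => b x (g x))
      (u := U) ?_ hode hyU
    exact hfU.comp contDiffOn_snd fun q hq => hq.2
  obtain ⟨h₁, hh₁, C, hC⟩ := hML.exists_local_error hs hT₁0 hyX hode (hgU.comp hys hyU)
    (hbU.comp hys hyU) (A := fun t => A (y t))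
    (hA.comp (hys.of_le (by exact_mod_cast Nat.sub_le s 1)) hyU) hp hC₀
    (fun t ht x hx => hlin _ (hyX ht) x hx)
  have hκ := projBound_nonneg s
  set κ := projBound s with hκdef
  set a₁ := κ * (M * (κ * M)) with ha₁
  set a₂ := κ * (2 * M * L * κ) with ha₂
  have ha₁0 : 0 ≤ a₁ := by positivity
  have ha₂0 : 0 ≤ a₂ := by positivity
  refine ⟨min h₁ (min (R / (a₁ + 1)) (1 / (2 * a₂ + 1))),
    ⟨lt_min hh₁.1 (by positivity), (min_le_left _ _).trans (hh₁.2.trans (min_le_left _ _))⟩, C,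
    fun h hh => ?_⟩
  have hh0 : 0 < h := hh.1
  have hhh₁ : h ∈ Ioc 0 h₁ := ⟨hh0, hh.2.trans (min_le_left _ _)⟩
  have hball : h * a₁ ≤ R := by
    have : h ≤ R / (a₁ + 1) := hh.2.trans ((min_le_right _ _).trans (min_le_left _ _))
    rw [le_div_iff₀ (by positivity)] at this
    linarith
  have hsmall : h * a₂ ≤ 1 / 2 := by
    have : h ≤ 1 / (2 * a₂ + 1) := hh.2.trans ((min_le_right _ _).trans (min_le_right _ _))
    rw [le_div_iff₀ (by positivity)] at this
    linarith
  -- paths in `K` stay in the ball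
  have hpath : ∀ σ : ℝ → EuclideanSpace ℝ (Fin m), IsProcedurePath H B s y₀ h σ →
      MapsTo σ (Icc 0 h) K → (fun c => σ (c * h)) 0 = y₀ ∧
      MapsTo (fun c => σ (c * h)) (Icc 0 1) X ∧ ∀ c ∈ Icc (0 : ℝ) 1,
        HasDerivWithinAt (fun c => σ (c * h)) (h • procField b g s (fun c => σ (c * h)) c)
          (Icc 0 1) c := by
    intro σ hσ hσK
    have huK : MapsTo (fun c => σ (c * h)) (Icc 0 1) K :=
      hσK.comp (mapsTo_mul_Icc ⟨hh0.le, le_rfl⟩)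
    obtain ⟨hu0, hu⟩ := (isProcedurePath_iff hBK hbK hh0 (fun _ => rfl) huK).1 hσ
    refine ⟨hu0, fun c hc => ?_, hu⟩
    have := norm_sub_le_of_procField hM hbM hgM hh0.le huK hu hc
    rw [hu0] at this
    rw [hX, Metric.mem_closedBall, dist_eq_norm]
    exact this.trans hball
  refine ⟨?_, fun σ σ' hσ hσK hσ' hσK' => ?_, fun σ hσ hσK => ?_⟩
  · obtain ⟨u, hu0, huX, hu⟩ := hML.exists_procedure hh0 hball hsmall
    have huσ : ∀ c, (fun t => u (t * h⁻¹)) (c * h) = u c := fun c => by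
      simp only [mul_inv_cancel_right₀ hh0.ne']
    refine ⟨fun t => u (t * h⁻¹), (isProcedurePath_iff hBK hbK hh0 huσ
      (huX.mono_right hRK)).2 ⟨hu0, hu⟩,
      fun t ht => hRK (huX (mapsTo_mul_inv_Icc hh0 ht))⟩
  · obtain ⟨hu0, huX, hu⟩ := hpath σ hσ hσK
    obtain ⟨hv0, hvX, hv⟩ := hpath σ' hσ' hσK'
    have heq := hML.procedure_unique hh0 hsmall (hu0.trans hv0.symm) huX hvX hu hv
    intro t ht
    have := heq (mapsTo_mul_inv_Icc hh0 ht)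
    simpa only [inv_mul_cancel_right₀ hh0.ne'] using this
  · obtain ⟨hu0, huX, hu⟩ := hpath σ hσ hσK
    have := hC h hhh₁ _ (hu0.trans hy.initial.symm) huX hu
    simpa only [one_mul] using this
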